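/- **Graphs.** A graph is a diagram of finite sets $A \xleftarrow{s} H \xrightarrow{p} V$ together with a map $i\colon A\to A$, where $s$ is injective and $i$ is a fixpoint-free involution ($V$: vertices, $H$: flags, $A$: arcs). The ports are the arcs outside $s(H)$; an edge $\{a,i(a)\}$ is isolated if neither of its arcs lies in $s(H)$; a graph is effective if it is nonempty and has no isolated edges. An etale morphism is a morphism of such diagrams (compatible with $i,s,p$) whose square on $H\to V$ is a pullback; an open subgraph inclusion is a levelwise injective etale morphism. An etale morphism is a cover if it is surjective on vertices and on edges, and a reduced cover if moreover its domain cannot be replaced by a proper open subgraph without losing this surjectivity. **Monad.** A graphical species $F$ is a presheaf on the category of elementary graphs (the unit graph $I$, consisting of one edge and no vertices, and the corollas $\mathbf n$, for finite sets $n$), that is, a set $F[I]$ of colours with an involution and sets $F[\mathbf n]$ of operations, functorial for bijections of $n$, with compatible projections to the colours. Every graph $G$ represents a graphical species, and we put $F[G]=\operatorname{Hom}(G,F)$. Let $F\mapsto\overline F$ be the monad with $\overline F[I]=F[I]$ and with $\overline F[\mathbf n]$ the set of isomorphism classes of pairs $(G,d)$ of an effective graph $G$ whose ports are identified with those of $\mathbf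 n$ and an element $d\in F[G]$. Its multiplication substitutes decorated graphs into the vertices of a graph and glues them along its edges; its unit regards an operation as a decorated corolla. **Kleisli category.** Let $\widetilde{\mathbf{Gr}}$ be the full subcategory of the Kleisli category of this monad whose objects are the graphs without isolated edges; a morphism $R\to Y$ is thus a morphism of graphical species $R\to\overline Y$. It assigns to each vertex $x$ of $R$ an effective graph $S_x$, etale over $Y$, whose ports are identified with those of the corolla of $R$ at $x$. Gluing the graphs $S_x$ in the way the corollas of $R$ are glued to give $R$ yields a graph $S$ that is etale over $Y$. The morphism $R\to Y$ is called generic if $S\to Y$ is an isomorphism. A morphism of $\widetilde{\mathbf{Gr}}$ is called a reduced cover if it is the image, under the canonical functor to the Kleisli category, of an etale morphism that is a reduced cover. **Proposition.** Let $r\colon R\to R'$ be a reduced cover and $g\colon R\to S$ a generic morphism in $\widetilde{\mathbf{Gr}}$. Then $r$ and $g$ have a pushout in $\widetilde{\mathbf{Gr}}$, and in every pushout square $$\begin{array}{ccc} R & \xrightarrow{\;r\;} & R'\\ {\scriptstyle g}\downarrow & & \downarrow{\scriptstyle g'}\\ S & \xrightarrow{\;r'\;} & S'\end{array}$$ the morphism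 $g'\colon R'\to S'$ is generic and the morphism $r'\colon S\to S'$ is a reduced cover. -/

import Mathlib

open CategoryTheory

namespace KockGraph

/-! ### Graphs and etale morphisms -/

/-- A graph: a diagram of finite sets `A ⟲ i`, `A ←s- H -p→ V` with `s` injective and `i` a
fixpoint-free involution.  `V` is the set of vertices, `H` the set of flags, `A` the set of arcs. -/
structure Graph : Type 1 where
  V : Type
  H : Type
  A : Type
  [finV : Finite V]
  [finH : Finite H]
  [finA : Finite A]
  i : A → A
  s : H → A
  p : H → V
  i_i : ∀ a, i (i a) = a
  i_ne : ∀ a, i a ≠ a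
  s_inj : Function.Injective s

attribute [instance] Graph.finV Graph.finH Graph.finA

namespace Graph

/-- The flags at the vertex `v`. -/
abbrev Flag (G : Graph) (v : G.V) : Type := {h : G.H // G.p h = v}

/-- The ports of `G`: the arcs outside the image of `s`. -/
abbrev Port (G : Graph) : Type := {a : G.A // a ∉ Set.range G.s}

/-- The arc `a` belongs to an inner edge. -/
def IsInner (G : Graph) (a : G.A) : Prop := a ∈ Set.range G.s ∧ G.i a ∈ Set.range G.s

/-- The edge of every arc has at least one of its two arcs in the image of `s`. -/
def NoIsolatedEdges (G : Graph) : Prop := ∀ a, a ∈ Set.range G.s ∨ G.i a ∈ Set.range G.s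

/-- A graph is effective if it is nonempty and has no isolated edges. -/
def Effective (G : Graph) : Prop := (Nonempty G.A ∨ Nonempty G.V) ∧ G.NoIsolatedEdges

/-- An etale morphism of graphs: a map of diagrams whose `H`-`V` square is a pullback. -/
@[ext]
structure Hom (G G' : Graph) : Type where
  A : G.A → G'.A
  H : G.H → G'.H
  V : G.V → G'.V
  map_i : ∀ a, A (G.i a) = G'.i (A a)
  map_s : ∀ h, A (G.s h) = G'.s (H h)
  map_p : ∀ h, V (G.p h) = G'.p (H h)
  pullback : ∀ (v : G.V) (h' : G'.H), G'.p h' = V v → ∃! h : G.H, G.p h = v ∧ H h = h'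

/-- The category of graphs and etale morphisms. -/
instance : Category Graph where
  Hom := Hom
  id G :=
    { A := fun a => a
      H := fun h => h
      V := fun v => v
      map_i := fun _ => rfl
      map_s := fun _ => rfl
      map_p := fun _ => rfl
      pullback := fun v h' hh => ⟨h', ⟨hh, rfl⟩, fun y hy => hy.2⟩ }
  comp f g :=
    { A := fun a => g.A (f.A a)
      H := fun h => g.H (f.H h)
      V := fun v => g.V (f.V v)
      map_i := fun a => by rw [f.map_i, g.map_i]
      map_s := fun h => by rw [f.map_s, g.map_s]
      map_p := fun h => by rw [f.map_p, g.map_p]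
      pullback := fun v h' hh => by
        obtain ⟨k, ⟨hk, hk'⟩, ku⟩ := g.pullback (f.V v) h' hh
        obtain ⟨l, ⟨hl, hl'⟩, lu⟩ := f.pullback v k hk
        refine ⟨l, ⟨hl, by simp only [hl', hk']⟩, fun y hy => lu y ⟨hy.1, ku _ ⟨?_, hy.2⟩⟩⟩
        rw [← f.map_p, hy.1] }

section basic

variable {G G' G'' : Graph}

@[ext]
theorem hom_ext {f g : G ⟶ G'} (hA : ∀ a, f.A a = g.A a) (hH : ∀ h, f.H h = g.H h)
    (hV : ∀ v, f.V v = g.V v) : f = g :=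
  Hom.ext (funext hA) (funext hH) (funext hV)

@[simp] theorem id_A (a : G.A) : Hom.A (𝟙 G) a = a := rfl
@[simp] theorem id_H (a : G.H) : Hom.H (𝟙 G) a = a := rfl
@[simp] theorem id_V (a : G.V) : Hom.V (𝟙 G) a = a := rfl
@[simp] theorem comp_A (f : G ⟶ G') (g : G' ⟶ G'') (a : G.A) : (f ≫ g).A a = g.A (f.A a) := rfl
@[simp] theorem comp_H (f : G ⟶ G') (g : G' ⟶ G'') (a : G.H) : (f ≫ g).H a = g.H (f.H a) := rfl
@[simp] theorem comp_V (f : G ⟶ G') (g : G' ⟶ G'') (a : G.V) : (f ≫ g).V a = g.V (f.V a) := rfl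

/-- The bijection between the flags at `v` and the flags at the image of `v`. -/
noncomputable def Hom.flagEquiv (f : G ⟶ G') (v : G.V) : G.Flag v ≃ G'.Flag (f.V v) :=
  Equiv.ofBijective (fun h => ⟨f.H h.1, by rw [← f.map_p, h.2]⟩) (by
    constructor
    · intro a b hab
      have hab' : f.H a.1 = f.H b.1 := congrArg Subtype.val hab
      have := f.pullback v (f.H a.1) (by rw [← f.map_p, a.2])
      exact Subtype.ext (this.unique ⟨a.2, rfl⟩ ⟨b.2, hab'.symm⟩)
    · intro b
      obtain ⟨k, ⟨hk, hk'⟩, -⟩ := f.pullback v b.1 b.2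
      exact ⟨⟨k, hk⟩, Subtype.ext hk'⟩)

@[simp] theorem flagEquiv_val (f : G ⟶ G') (v : G.V) (h : G.Flag v) :
    (Hom.flagEquiv f v h).1 = f.H h.1 := rfl

/-- An isomorphism of graphs from levelwise bijections. -/
def isoMk (eA : G.A ≃ G'.A) (eH : G.H ≃ G'.H) (eV : G.V ≃ G'.V)
    (hi : ∀ a, eA (G.i a) = G'.i (eA a)) (hs : ∀ h, eA (G.s h) = G'.s (eH h))
    (hp : ∀ h, eV (G.p h) = G'.p (eH h)) : G ≅ G' where
  hom :=
    { A := eA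
      H := eH
      V := eV
      map_i := hi
      map_s := hs
      map_p := hp
      pullback := fun v h' hh =>
        ⟨eH.symm h', ⟨eV.injective (by rw [hp, Equiv.apply_symm_apply, hh]), by simp⟩,
          fun y hy => by rw [← hy.2, Equiv.symm_apply_apply]⟩ }
  inv :=
    { A := eA.symm
      H := eH.symm
      V := eV.symm
      map_i := fun a => eA.injective (by simp [hi])
      map_s := fun a => eA.injective (by simp [hs])
      map_p := fun a => eV.injective (by simp [hp])
      pullback := fun v h' hh =>
        ⟨eH h', ⟨by rw [← hp, hh, Equiv.apply_symm_apply], by simp⟩,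
          fun y hy => by rw [← hy.2, Equiv.apply_symm_apply]⟩ }
  hom_inv_id := by ext a <;> simp
  inv_hom_id := by ext a <;> simp

/-- The levelwise bijections underlying an isomorphism of graphs. -/
def equivA (θ : G ≅ G') : G.A ≃ G'.A where
  toFun := θ.hom.A
  invFun := θ.inv.A
  left_inv a := by rw [← comp_A, θ.hom_inv_id, id_A]
  right_inv a := by rw [← comp_A, θ.inv_hom_id, id_A]

/-- The levelwise bijections underlying an isomorphism of graphs. -/
def equivH (θ : G ≅ G') : G.H ≃ G'.H where
  toFun := θ.hom.H
  invFun := θ.inv.H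
  left_inv a := by rw [← comp_H, θ.hom_inv_id, id_H]
  right_inv a := by rw [← comp_H, θ.inv_hom_id, id_H]

/-- The levelwise bijections underlying an isomorphism of graphs. -/
def equivV (θ : G ≅ G') : G.V ≃ G'.V where
  toFun := θ.hom.V
  invFun := θ.inv.V
  left_inv a := by rw [← comp_V, θ.hom_inv_id, id_V]
  right_inv a := by rw [← comp_V, θ.inv_hom_id, id_V]

@[simp] theorem equivA_apply (θ : G ≅ G') (a : G.A) : equivA θ a = θ.hom.A a := rfl
@[simp] theorem equivH_apply (θ : G ≅ G') (a : G.H) : equivH θ a = θ.hom.H a := rfl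
@[simp] theorem equivV_apply (θ : G ≅ G') (a : G.V) : equivV θ a = θ.hom.V a := rfl

theorem isInner_iso (θ : G ≅ G') (a : G.A) : G.IsInner a ↔ G'.IsInner (θ.hom.A a) := by
  have key : ∀ a, a ∈ Set.range G.s ↔ θ.hom.A a ∈ Set.range G'.s := by
    intro a
    constructor
    · rintro ⟨h, rfl⟩
      exact ⟨θ.hom.H h, (θ.hom.map_s h).symm⟩
    · rintro ⟨h, hh⟩
      refine ⟨θ.inv.H h, ?_⟩
      rw [← θ.inv.map_s, hh, ← comp_A, θ.hom_inv_id, id_A]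
  unfold IsInner
  rw [key, key, θ.hom.map_i]

theorem isInner_i {a : G.A} (h : G.IsInner a) : G.IsInner (G.i a) :=
  ⟨h.2, by rw [G.i_i]; exact h.1⟩

end basic

/-! ### Covers and reduced covers -/

/-- A covering morphism: an etale morphism that is surjective on vertices and on edges (that is, on
arcs, since etale morphisms respect the involutions). -/
def Hom.IsCover {G X : Graph} (f : G ⟶ X) : Prop :=
  Function.Surjective f.V ∧ Function.Surjective f.A

/-- A levelwise injective etale morphism, that is, the inclusion of an (open) subgraph. -/
def Hom.IsSubgraph {U G : Graph} (u : U ⟶ G) : Prop :=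
  Function.Injective u.A ∧ Function.Injective u.H ∧ Function.Injective u.V

/-- A reduced cover: a cover whose domain cannot be replaced by a proper subgraph. -/
def Hom.IsReducedCover {G X : Graph} (f : G ⟶ X) : Prop :=
  Hom.IsCover f ∧
    ∀ (U : Graph) (u : U ⟶ G), Hom.IsSubgraph u → Hom.IsCover (u ≫ f) → IsIso u

end Graph

/-! ### Graphical species -/

/-- A graphical species: an involutive set `C` of colours and, for every finite set `n`, a set
`Op n` of operations, functorial for bijections of `n`, with a colour for every element of `n`.
In terms of presheaves on elementary graphs, `C` is the value on the unit graph, `Op n` the value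
on the corolla with set of flags `n`, and `col x j` the restriction of `x` along the arc `s j`;
the restriction along the opposite arc `i (s j)`, which is a port, is `inv (col x j)`. -/
structure Species : Type 2 where
  C : Type 1
  inv : C → C
  inv_inv : ∀ c, inv (inv c) = c
  Op : (n : Type) → [Finite n] → Type 1
  relabel : ∀ {n m : Type} [Finite n] [Finite m], (n ≃ m) → Op n → Op m
  relabel_refl : ∀ {n : Type} [Finite n] (x : Op n), relabel (Equiv.refl n) x = x
  relabel_trans : ∀ {n m k : Type} [Finite n] [Finite m] [Finite k] (e : n ≃ m) (f : m ≃ k)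
    (x : Op n), relabel (e.trans f) x = relabel f (relabel e x)
  col : ∀ {n : Type} [Finite n], Op n → n → C
  col_relabel : ∀ {n m : Type} [Finite n] [Finite m] (e : n ≃ m) (x : Op n) (j : m),
    col (relabel e x) j = col x (e.symm j)

namespace Species

/-- A morphism of graphical species. -/
@[ext]
structure Hom (F F' : Species) : Type 1 where
  C : F.C → F'.C
  onOp : ∀ {n : Type} [Finite n], F.Op n → F'.Op n
  map_inv : ∀ c, C (F.inv c) = F'.inv (C c)
  map_relabel : ∀ {n m : Type} [Finite n] [Finite m] (e : n ≃ m) (x : F.Op n),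
    onOp (F.relabel e x) = F'.relabel e (onOp x)
  map_col : ∀ {n : Type} [Finite n] (x : F.Op n) (j : n), F'.col (onOp x) j = C (F.col x j)

/-- The category of graphical species. -/
instance : Category Species where
  Hom := Hom
  id F :=
    { C := fun c => c
      onOp := fun x => x
      map_inv := fun _ => rfl
      map_relabel := fun _ _ => rfl
      map_col := fun _ _ => rfl }
  comp f g :=
    { C := fun c => g.C (f.C c)
      onOp := fun x => g.onOp (f.onOp x)
      map_inv := fun c => by rw [f.map_inv, g.map_inv]
      map_relabel := fun e x => by rw [f.map_relabel, g.map_relabel]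
      map_col := fun x j => by rw [g.map_col, f.map_col] }

variable {F F' F'' : Species}

@[ext]
theorem hom_ext {f g : F ⟶ F'} (hC : ∀ c, f.C c = g.C c)
    (hop : ∀ (n : Type) [Finite n] (x : F.Op n), f.onOp x = g.onOp x) : f = g :=
  Hom.ext (funext hC) (by funext n _ x; exact hop n x)

@[simp] theorem id_C (c : F.C) : Hom.C (𝟙 F) c = c := rfl
@[simp] theorem id_op {n : Type} [Finite n] (x : F.Op n) : Hom.onOp (𝟙 F) x = x := rfl
@[simp] theorem comp_C (f : F ⟶ F') (g : F' ⟶ F'') (c : F.C) : (f ≫ g).C c = g.C (f.C c) := rfl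
@[simp] theorem comp_op (f : F ⟶ F') (g : F' ⟶ F'') {n : Type} [Finite n] (x : F.Op n) :
    (f ≫ g).onOp x = g.onOp (f.onOp x) := rfl

end Species

open KockGraph.Graph KockGraph.Species

/-- The embedding of graphs into graphical species.  The colours of `G` are its arcs, and an
`n`-ary operation is an etale morphism from the corolla with flags `n` to `G`, that is, a vertex
`v` together with a bijection from `n` to the flags at `v`. -/
noncomputable def toSpecies : Graph ⥤ Species where
  obj G :=
    { C := ULift.{1} G.A
      inv := fun a => ⟨G.i a.down⟩
      inv_inv := fun a => by simp [G.i_i]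
      Op := fun n _ => ULift.{1} (Σ v : G.V, n ≃ G.Flag v)
      relabel := fun e x => ⟨⟨x.down.1, e.symm.trans x.down.2⟩⟩
      relabel_refl := fun _ => rfl
      relabel_trans := fun _ _ _ => rfl
      col := fun x j => ⟨G.s (x.down.2 j).1⟩
      col_relabel := fun _ _ _ => rfl }
  map f :=
    { C := fun a => ⟨f.A a.down⟩
      onOp := fun x => ⟨⟨f.V x.down.1, x.down.2.trans (Graph.Hom.flagEquiv f x.down.1)⟩⟩
      map_inv := fun a => by simp [f.map_i]
      map_relabel := fun _ _ => rfl
      map_col := fun x j => by simp [f.map_s] }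
  map_id G := by
    refine Species.hom_ext (fun _ => rfl) (fun n _ x => ?_)
    exact congrArg (fun e => ULift.up (Sigma.mk x.down.1 e)) (Equiv.ext fun _ => Subtype.ext rfl)
  map_comp f g := by
    refine Species.hom_ext (fun _ => rfl) (fun n _ x => ?_)
    exact congrArg (fun e => ULift.up (Sigma.mk (g.V (f.V x.down.1)) e))
      (Equiv.ext fun _ => Subtype.ext rfl)

section decorations

variable {G G' : Graph} {F F' : Species}

/-- The colour of the arc `a` in the `F`-graph `φ`. -/
def arcOf (φ : toSpecies.obj G ⟶ F) (a : G.A) : F.C := φ.C (ULift.up a)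

/-- The operation at the vertex `v` in the `F`-graph `φ`. -/
def vertOf (φ : toSpecies.obj G ⟶ F) (v : G.V) : F.Op (G.Flag v) :=
  φ.onOp (n := G.Flag v) (ULift.up ⟨v, Equiv.refl _⟩)

theorem op_eq (φ : toSpecies.obj G ⟶ F) {n : Type} [Finite n] (v : G.V) (e : n ≃ G.Flag v) :
    φ.onOp (n := n) (ULift.up ⟨v, e⟩) = F.relabel e.symm (vertOf φ v) :=
  φ.map_relabel e.symm (ULift.up ⟨v, Equiv.refl _⟩)

theorem arcOf_i (φ : toSpecies.obj G ⟶ F) (a : G.A) : arcOf φ (G.i a) = F.inv (arcOf φ a) :=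
  φ.map_inv (ULift.up a)

theorem col_vertOf (φ : toSpecies.obj G ⟶ F) (v : G.V) (h : G.Flag v) :
    F.col (vertOf φ v) h = arcOf φ (G.s h.1) :=
  φ.map_col (n := G.Flag v) (ULift.up ⟨v, Equiv.refl _⟩) h

theorem dec_ext {φ ψ : toSpecies.obj G ⟶ F} (hA : ∀ a, arcOf φ a = arcOf ψ a)
    (hV : ∀ v, vertOf φ v = vertOf ψ v) : φ = ψ := by
  refine Species.hom_ext (fun c => hA (ULift.down c)) ?_
  rintro n _ ⟨⟨v, e⟩⟩
  rw [op_eq, op_eq, hV]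

/-- An `F`-graph is given by colours of the arcs and operations at the vertices. -/
def ofLocal (c : G.A → F.C) (hc : ∀ a, c (G.i a) = F.inv (c a)) (d : ∀ v, F.Op (G.Flag v))
    (hd : ∀ v h, F.col (d v) h = c (G.s h.1)) : toSpecies.obj G ⟶ F where
  C := fun (a : ULift G.A) => c a.down
  onOp := fun {n} _ (x : ULift (Σ v : G.V, n ≃ G.Flag v)) => F.relabel x.down.2.symm (d x.down.1)
  map_inv := fun (a : ULift G.A) => hc a.down
  map_relabel e x := by
    rw [← F.relabel_trans]
    rfl
  map_col x j := by
    rw [F.col_relabel, hd]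
    rfl

@[simp] theorem arcOf_ofLocal (c : G.A → F.C) (hc d hd) (a : G.A) :
    arcOf (ofLocal c hc d hd) a = c a := rfl

@[simp] theorem vertOf_ofLocal (c : G.A → F.C) (hc d hd) (v : G.V) :
    vertOf (ofLocal c hc d hd) v = d v := F.relabel_refl _

@[simp] theorem arcOf_map_comp (f : G ⟶ G') (φ : toSpecies.obj G' ⟶ F) (a : G.A) :
    arcOf (toSpecies.map f ≫ φ) a = arcOf φ (f.A a) := rfl

theorem vertOf_map_comp (f : G ⟶ G') (φ : toSpecies.obj G' ⟶ F) (v : G.V) :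
    vertOf (toSpecies.map f ≫ φ) v =
      F.relabel (Graph.Hom.flagEquiv f v).symm (vertOf φ (f.V v)) :=
  op_eq φ (f.V v) (Graph.Hom.flagEquiv f v)

theorem arcOf_comp (φ : toSpecies.obj G ⟶ F) (ψ : F ⟶ F') (a : G.A) :
    arcOf (φ ≫ ψ) a = ψ.C (arcOf φ a) := rfl

theorem vertOf_comp (φ : toSpecies.obj G ⟶ F) (ψ : F ⟶ F') (v : G.V) :
    vertOf (φ ≫ ψ) v = ψ.onOp (vertOf φ v) := rfl

end decorations

/-! ### Effective `n`-graphs -/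

/-- An effective `n`-graph, where `n` is identified with the set of ports of the corolla with
flags `n`. -/
structure NGraph (n : Type) : Type 1 where
  graph : Graph
  eff : graph.Effective
  port : n ≃ graph.Port

namespace NGraph

variable {n : Type}

/-- Relabelling the ports. -/
@[reducible]
def relabel {m : Type} (e : n ≃ m) (K : NGraph n) : NGraph m where
  graph := K.graph
  eff := K.eff
  port := e.symm.trans K.port

theorem i_port_mem (K : NGraph n) (j : n) : K.graph.i (K.port j).1 ∈ Set.range K.graph.s :=
  (K.eff.2 _).resolve_left (K.port j).2

theorem not_isInner_port (K : NGraph n) (j : n) : ¬ K.graph.IsInner (K.port j).1 :=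
  fun h => (K.port j).2 h.1

theorem not_isInner_i_port (K : NGraph n) (j : n) : ¬ K.graph.IsInner (K.graph.i (K.port j).1) :=
  fun h => (K.port j).2 (by have := h.2; rwa [K.graph.i_i] at this)

theorem arc_cases (K : NGraph n) (a : K.graph.A) :
    (∃ j, a = (K.port j).1) ∨ (∃ j, a = K.graph.i (K.port j).1) ∨ K.graph.IsInner a := by
  by_cases h : a ∈ Set.range K.graph.s
  · by_cases h' : K.graph.i a ∈ Set.range K.graph.s
    · exact Or.inr (Or.inr ⟨h, h'⟩)
    · refine Or.inr (Or.inl ⟨K.port.symm ⟨_, h'⟩, ?_⟩)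
      simp [K.graph.i_i]
  · exact Or.inl ⟨K.port.symm ⟨_, h⟩, by simp⟩

end NGraph

/-! ### Gluing: substituting graphs into the vertices of a graph -/

section glue

variable (G : Graph) (K : ∀ v, NGraph (G.Flag v))

/-- The arcs of the graph obtained by gluing the graphs `K v` according to `G`: the arcs of `G`,
and the arcs of the inner edges of the `K v`. -/
abbrev GlueA : Type := G.A ⊕ Σ v, {a : (K v).graph.A // (K v).graph.IsInner a}

open Classical in
/-- The map from the arcs of `K v` to the arcs of the glued graph: the port of `K v` labelled by
the flag `j` is identified with the port `i (s j)` of the corolla of `G` at `v`. -/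
noncomputable def glueArc (v : G.V) (a : (K v).graph.A) : GlueA G K :=
  if h : (K v).graph.IsInner a then Sum.inr ⟨v, a, h⟩
  else if h' : a ∉ Set.range (K v).graph.s then
    Sum.inl (G.i (G.s ((K v).port.symm ⟨a, h'⟩).1))
  else
    Sum.inl (G.s ((K v).port.symm
      ⟨(K v).graph.i a, fun h'' => h ⟨not_not.mp h', h''⟩⟩).1)

variable {G K}

theorem glueArc_inner {v : G.V} {a : (K v).graph.A} (h : (K v).graph.IsInner a) :
    glueArc G K v a = Sum.inr ⟨v, a, h⟩ := by
  rw [glueArc, dif_pos h]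

@[simp] theorem glueArc_port (v : G.V) (j : G.Flag v) :
    glueArc G K v ((K v).port j).1 = Sum.inl (G.i (G.s j.1)) := by
  rw [glueArc, dif_neg ((K v).not_isInner_port j), dif_pos ((K v).port j).2]
  simp

@[simp] theorem glueArc_i_port (v : G.V) (j : G.Flag v) :
    glueArc G K v ((K v).graph.i ((K v).port j).1) = Sum.inl (G.s j.1) := by
  rw [glueArc, dif_neg ((K v).not_isInner_i_port j),
    dif_neg (not_not.mpr ((K v).i_port_mem j))]
  simp [(K v).graph.i_i]

variable (G K)

/-- The involution on the arcs of the glued graph. -/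
def glueI : GlueA G K → GlueA G K :=
  Sum.map G.i (fun x => ⟨x.1, (K x.1).graph.i x.2.1, isInner_i x.2.2⟩)

variable {G K}

theorem glueArc_i (v : G.V) (a : (K v).graph.A) :
    glueArc G K v ((K v).graph.i a) = glueI G K (glueArc G K v a) := by
  rcases (K v).arc_cases a with ⟨j, rfl⟩ | ⟨j, rfl⟩ | h
  · simp [glueI, G.i_i]
  · rw [(K v).graph.i_i]
    simp [glueI]
  · rw [glueArc_inner h, glueArc_inner (isInner_i h)]
    rfl

theorem glueArc_s_inj (v : G.V) (h : (K v).graph.H) (w : G.V) (k : (K w).graph.H)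
    (e : glueArc G K v ((K v).graph.s h) = glueArc G K w ((K w).graph.s k)) :
    (⟨v, h⟩ : Σ v, (K v).graph.H) = ⟨w, k⟩ := by
  rcases (K v).arc_cases ((K v).graph.s h) with ⟨j, hj⟩ | ⟨j, hj⟩ | hj
  · exact absurd ⟨h, hj⟩ ((K v).port j).2
  · rcases (K w).arc_cases ((K w).graph.s k) with ⟨l, hl⟩ | ⟨l, hl⟩ | hl
    · exact absurd ⟨k, hl⟩ ((K w).port l).2
    · rw [hj, hl, glueArc_i_port, glueArc_i_port] at e
      have e' := G.s_inj (Sum.inl.inj e)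
      have hvw : v = w := by rw [← j.2, ← l.2, e']
      subst hvw
      have : j = l := Subtype.ext e'
      subst this
      rw [(K v).graph.s_inj (hj.trans hl.symm)]
    · rw [hj, glueArc_i_port, glueArc_inner hl] at e
      cases e
  · rcases (K w).arc_cases ((K w).graph.s k) with ⟨l, hl⟩ | ⟨l, hl⟩ | hl
    · exact absurd ⟨k, hl⟩ ((K w).port l).2
    · rw [hl, glueArc_i_port, glueArc_inner hj] at e
      cases e
    · rw [glueArc_inner hj, glueArc_inner hl] at e
      have e' := Sum.inr.inj e
      rw [Sigma.mk.injEq] at e'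
      obtain ⟨hvw, e''⟩ := e'
      subst hvw
      rw [(K v).graph.s_inj (congrArg Subtype.val (eq_of_heq e''))]

variable (G K)

/-- The graph obtained by gluing the graphs `K v` in the same way as the corollas of `G` are glued
to give `G`; it is the colimit of the diagram indexed by the elements of `G` that sends the
vertex `v` to `K v` and every edge to the unit graph. -/
@[reducible]
noncomputable def glue : Graph where
  V := Σ v, (K v).graph.V
  H := Σ v, (K v).graph.H
  A := GlueA G K
  i := glueI G K
  s x := glueArc G K x.1 ((K x.1).graph.s x.2)
  p x := ⟨x.1, (K x.1).graph.p x.2⟩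
  i_i := by
    rintro (a | ⟨v, a, h⟩)
    · simp [glueI, G.i_i]
    · simp [glueI, (K v).graph.i_i]
  i_ne := by
    rintro (a | ⟨v, a, h⟩) e
    · exact G.i_ne a (Sum.inl.inj e)
    · have e' := Sum.inr.inj e
      simp only [Sigma.mk.injEq, heq_eq_eq, true_and, Subtype.mk.injEq] at e'
      exact (K v).graph.i_ne a e'
  s_inj := by
    rintro ⟨v, h⟩ ⟨w, k⟩ e
    exact glueArc_s_inj v h w k e

/-- The canonical etale morphism from `K v` to the glued graph. -/
noncomputable def glueIncl (v : G.V) : (K v).graph ⟶ glue G K where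
  A := glueArc G K v
  H h := ⟨v, h⟩
  V w := ⟨v, w⟩
  map_i := glueArc_i v
  map_s _ := rfl
  map_p _ := rfl
  pullback := by
    rintro w ⟨v', h⟩ e
    have e' : (⟨v', (K v').graph.p h⟩ : Σ v, (K v).graph.V) = ⟨v, w⟩ := e
    rw [Sigma.mk.injEq] at e'
    obtain ⟨hv, e''⟩ := e'
    subst hv
    refine ⟨h, ⟨eq_of_heq e'', rfl⟩, fun y hy => ?_⟩
    have := hy.2
    exact eq_of_heq (Sigma.mk.inj this).2

variable {G K}

@[simp] theorem glueIncl_A (v : G.V) (a) : (glueIncl G K v).A a = glueArc G K v a := rfl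
@[simp] theorem glueIncl_V (v : G.V) (a) : (glueIncl G K v).V a = ⟨v, a⟩ := rfl
@[simp] theorem glueIncl_H (v : G.V) (a) : (glueIncl G K v).H a = ⟨v, a⟩ := rfl

theorem inl_mem_range_iff (a : G.A) :
    (Sum.inl a : GlueA G K) ∈ Set.range (glue G K).s ↔ a ∈ Set.range G.s := by
  constructor
  · rintro ⟨⟨v, h⟩, e⟩
    change glueArc G K v ((K v).graph.s h) = Sum.inl a at e
    rcases (K v).arc_cases ((K v).graph.s h) with ⟨j, hj⟩ | ⟨j, hj⟩ | hj
    · exact absurd ⟨h, hj⟩ ((K v).port j).2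
    · rw [hj, glueArc_i_port] at e
      exact ⟨j.1, Sum.inl.inj e⟩
    · rw [glueArc_inner hj] at e
      cases e
  · rintro ⟨k, rfl⟩
    obtain ⟨h, hh⟩ := (K (G.p k)).i_port_mem ⟨k, rfl⟩
    refine ⟨⟨G.p k, h⟩, ?_⟩
    change glueArc G K (G.p k) ((K (G.p k)).graph.s h) = _
    rw [hh, glueArc_i_port]

theorem inr_mem_range (x : Σ v, {a : (K v).graph.A // (K v).graph.IsInner a}) :
    (Sum.inr x : GlueA G K) ∈ Set.range (glue G K).s := by
  obtain ⟨v, a, ⟨h, rfl⟩, h'⟩ := x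
  exact ⟨⟨v, h⟩, glueArc_inner ⟨⟨h, rfl⟩, h'⟩⟩

theorem isInner_inl_iff (a : G.A) :
    (glue G K).IsInner (Sum.inl a : GlueA G K) ↔ G.IsInner a :=
  and_congr (inl_mem_range_iff a) (inl_mem_range_iff (G.i a))

theorem isInner_inr (x : Σ v, {a : (K v).graph.A // (K v).graph.IsInner a}) :
    (glue G K).IsInner (Sum.inr x : GlueA G K) :=
  ⟨inr_mem_range x, inr_mem_range _⟩

theorem glue_noIsolatedEdges (hG : G.NoIsolatedEdges) : (glue G K).NoIsolatedEdges := by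
  rintro (a | x)
  · exact (hG a).imp (inl_mem_range_iff a).2 (inl_mem_range_iff (G.i a)).2
  · exact Or.inl (inr_mem_range x)

theorem glue_effective (hG : G.Effective) : (glue G K).Effective := by
  refine ⟨?_, glue_noIsolatedEdges hG.2⟩
  rcases hG.1 with ⟨⟨a⟩⟩ | ⟨⟨v⟩⟩
  · exact Or.inl ⟨(Sum.inl a : GlueA G K)⟩
  · rcases (K v).eff.1 with ⟨⟨a⟩⟩ | ⟨⟨w⟩⟩
    · exact Or.inl ⟨glueArc G K v a⟩
    · exact Or.inr ⟨⟨v, w⟩⟩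

/-- The ports of the glued graph are the ports of `G`. -/
noncomputable def gluePort : G.Port ≃ (glue G K).Port :=
  Equiv.ofBijective
    (fun a => ⟨(Sum.inl a.1 : GlueA G K), fun h => a.2 ((inl_mem_range_iff a.1).1 h)⟩) (by
    constructor
    · intro a b e
      exact Subtype.ext (Sum.inl.inj (congrArg Subtype.val e))
    · rintro ⟨a | x, h⟩
      · exact ⟨⟨a, fun h' => h ((inl_mem_range_iff a).2 h')⟩, rfl⟩
      · exact absurd (inr_mem_range x) h)

@[simp] theorem gluePort_val (a : G.Port) :
    (gluePort (K := K) a).1 = (Sum.inl a.1 : GlueA G K) := rfl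

/-- Substitution of graphs into the vertices of an `n`-graph. -/
@[reducible]
noncomputable def NGraph.subst {n : Type} (N : NGraph n)
    (L : ∀ v, NGraph (N.graph.Flag v)) : NGraph n where
  graph := glue N.graph L
  eff := glue_effective N.eff
  port := N.port.trans gluePort

/-- `F`-graphs on the glued graph are determined on the arcs of `G` and on the `K v`. -/
theorem glue_dec_ext {F : Species} {φ ψ : toSpecies.obj (glue G K) ⟶ F}
    (h : ∀ a : G.A, arcOf φ (Sum.inl a : GlueA G K) = arcOf ψ (Sum.inl a : GlueA G K))
    (h' : ∀ v, toSpecies.map (glueIncl G K v) ≫ φ = toSpecies.map (glueIncl G K v) ≫ ψ) :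
    φ = ψ := by
  refine dec_ext ?_ ?_
  · rintro (a | ⟨v, a, ha⟩)
    · exact h a
    · have := congrArg (fun χ => arcOf χ a) (h' v)
      simpa [glueArc_inner ha] using this
  · rintro ⟨v, w⟩
    have := congrArg (fun χ => vertOf χ w) (h' v)
    simp only [vertOf_map_comp] at this
    have := congrArg (F.relabel (Graph.Hom.flagEquiv (glueIncl G K v) w)) this
    rw [← F.relabel_trans, ← F.relabel_trans, Equiv.symm_trans_self, F.relabel_refl,
      F.relabel_refl] at this
    exact this

section glueDec

variable {F : Species} (c : G.A → F.C) (hc : ∀ a, c (G.i a) = F.inv (c a))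
  (δ : ∀ v, toSpecies.obj (K v).graph ⟶ F)
  (hδ : ∀ v j, arcOf (δ v) ((K v).port j).1 = F.inv (c (G.s j.1)))

/-- The colours of the arcs of the glued graph. -/
def glueCol : GlueA G K → F.C := Sum.elim c (fun x => arcOf (δ x.1) x.2.1)

theorem glueCol_glueArc (hc : ∀ a, c (G.i a) = F.inv (c a))
    (hδ : ∀ v j, arcOf (δ v) ((K v).port j).1 = F.inv (c (G.s j.1))) (v : G.V) (a : (K v).graph.A) :
    glueCol c δ (glueArc G K v a) = arcOf (δ v) a := by
  rcases (K v).arc_cases a with ⟨j, rfl⟩ | ⟨j, rfl⟩ | h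
  · rw [glueArc_port, hδ, ← hc]
    rfl
  · rw [glueArc_i_port, arcOf_i, hδ, F.inv_inv]
    rfl
  · rw [glueArc_inner h]
    rfl

/-- The `F`-graph structure on the glued graph given by `F`-graph structures on the `K v` that
match the colours `c` of the arcs of `G`. -/
noncomputable def glueDec : toSpecies.obj (glue G K) ⟶ F :=
  ofLocal (G := glue G K) (glueCol c δ)
    (by
      rintro (a | ⟨v, a, h⟩)
      · exact hc a
      · exact arcOf_i (δ v) a)
    (fun x => F.relabel (Graph.Hom.flagEquiv (glueIncl G K x.1) x.2) (vertOf (δ x.1) x.2))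
    (by
      rintro ⟨v, w⟩ h
      obtain ⟨h, rfl⟩ := (Graph.Hom.flagEquiv (glueIncl G K v) w).surjective h
      refine (F.col_relabel _ _ _).trans ?_
      refine (congrArg (F.col _) (Equiv.symm_apply_apply _ h)).trans ?_
      refine (col_vertOf _ _ _).trans ?_
      exact (glueCol_glueArc c δ hc hδ v _).symm)

@[simp] theorem arcOf_glueDec_inl (a : G.A) :
    arcOf (glueDec c hc δ hδ) (Sum.inl a : GlueA G K) = c a := rfl

@[simp] theorem glueIncl_glueDec (v : G.V) :
    toSpecies.map (glueIncl G K v) ≫ glueDec c hc δ hδ = δ v := by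
  refine dec_ext (fun a => glueCol_glueArc c δ hc hδ v a) (fun w => ?_)
  refine (vertOf_map_comp _ _ _).trans ?_
  refine (congrArg (F.relabel _) (vertOf_ofLocal (G := glue G K) _ _ _ _ _)).trans ?_
  refine (F.relabel_trans _ _ _).symm.trans ?_
  exact (congrArg (fun e => F.relabel e _) (Equiv.self_trans_symm _)).trans (F.relabel_refl _)

end glueDec

/-- Gluing respects isomorphisms. -/
noncomputable def glueIso {G' : Graph} {K' : ∀ v, NGraph (G'.Flag v)} (θ : G ≅ G')
    (κ : ∀ v, (K v).graph ≅ (K' (θ.hom.V v)).graph)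
    (hκ : ∀ v j, (κ v).hom.A ((K v).port j).1 =
      ((K' (θ.hom.V v)).port (Graph.Hom.flagEquiv θ.hom v j)).1) : glue G K ≅ glue G' K' :=
  let eA : GlueA G K ≃ GlueA G' K' := Equiv.sumCongr (equivA θ)
    (Equiv.sigmaCongr (equivV θ) (fun v =>
      (equivA (κ v)).subtypeEquiv (fun a => isInner_iso (κ v) a)))
  isoMk eA
    (Equiv.sigmaCongr (equivV θ) (fun v => equivH (κ v)))
    (Equiv.sigmaCongr (equivV θ) (fun v => equivV (κ v)))
    (by
      rintro (a | ⟨v, a, h⟩)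
      · exact congrArg Sum.inl (θ.hom.map_i a)
      · refine congrArg Sum.inr (congrArg (Sigma.mk _) (Subtype.ext ((κ v).hom.map_i a))))
    (by
      rintro ⟨v, h⟩
      change eA (glueArc G K v ((K v).graph.s h)) =
        glueArc G' K' (θ.hom.V v) ((K' (θ.hom.V v)).graph.s ((κ v).hom.H h))
      rw [← (κ v).hom.map_s]
      generalize (K v).graph.s h = a
      rcases (K v).arc_cases a with ⟨j, rfl⟩ | ⟨j, rfl⟩ | h
      · rw [hκ, glueArc_port, glueArc_port]
        exact congrArg Sum.inl ((θ.hom.map_i _).trans (congrArg G'.i (θ.hom.map_s _)))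
      · rw [(κ v).hom.map_i, hκ, glueArc_i_port, glueArc_i_port]
        exact congrArg Sum.inl (θ.hom.map_s _)
      · rw [glueArc_inner h, glueArc_inner ((isInner_iso (κ v) a).1 h)]
        rfl)
    (by
      rintro ⟨v, h⟩
      exact congrArg (Sigma.mk _) ((κ v).hom.map_p h))

theorem glueIncl_glueIso {G' : Graph} {K' : ∀ v, NGraph (G'.Flag v)} (θ : G ≅ G')
    (κ : ∀ v, (K v).graph ≅ (K' (θ.hom.V v)).graph) (hκ) (v : G.V) :
    glueIncl G K v ≫ (glueIso θ κ hκ).hom = (κ v).hom ≫ glueIncl G' K' (θ.hom.V v) := by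
  refine Graph.hom_ext (fun a => ?_) (fun _ => rfl) (fun _ => rfl)
  · change (glueIso θ κ hκ).hom.A (glueArc G K v a) = glueArc G' K' (θ.hom.V v) ((κ v).hom.A a)
    rcases (K v).arc_cases a with ⟨j, rfl⟩ | ⟨j, rfl⟩ | h
    · rw [hκ, glueArc_port, glueArc_port]
      exact congrArg Sum.inl ((θ.hom.map_i _).trans (congrArg G'.i (θ.hom.map_s _)))
    · rw [(κ v).hom.map_i, hκ, glueArc_i_port, glueArc_i_port]
      exact congrArg Sum.inl (θ.hom.map_s _)
    · rw [glueArc_inner h, glueArc_inner ((isInner_iso (κ v) a).1 h)]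
      rfl

end glue

/-! ### The monad -/

/-- An effective `n`-graph `K` decorated by the graphical species `F`.  The set `F[K]` is the set
of morphisms of graphical species from `K` to `F`. -/
structure DecNGraph (F : Species) (n : Type) : Type 1 extends NGraph n where
  dec : toSpecies.obj graph ⟶ F

namespace DecNGraph

variable {F F' : Species} {n m : Type}

/-- Isomorphism of decorated `n`-graphs: an isomorphism of graphs that is compatible with the
labels of the ports and with the decorations. -/
def Rel (X Y : DecNGraph F n) : Prop :=
  ∃ θ : X.graph ≅ Y.graph, (∀ j, θ.hom.A (X.port j).1 = (Y.port j).1) ∧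
    toSpecies.map θ.hom ≫ Y.dec = X.dec

/-- The isomorphism relation on decorated `n`-graphs. -/
instance setoid (F : Species) (n : Type) : Setoid (DecNGraph F n) where
  r := Rel
  iseqv :=
    { refl := fun X => ⟨Iso.refl _, fun _ => rfl, by simp⟩
      symm := by
        rintro X Y ⟨θ, h, h'⟩
        refine ⟨θ.symm, fun j => ?_, ?_⟩
        · rw [← h j]
          exact (equivA θ).symm_apply_apply _
        · rw [← h', ← Category.assoc, ← toSpecies.map_comp]
          simp
      trans := by
        rintro X Y Z ⟨θ, h, h'⟩ ⟨ψ, k, k'⟩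
        refine ⟨θ ≪≫ ψ, fun j => ?_, ?_⟩
        · rw [← k j, ← h j]
          rfl
        · rw [← h', ← k']
          simp }

/-- Relabelling the ports. -/
def relabel (e : n ≃ m) (X : DecNGraph F n) : DecNGraph F m where
  toNGraph := X.toNGraph.relabel e
  dec := X.dec

/-- Change of decoration along a morphism of graphical species. -/
noncomputable def map (f : F ⟶ F') (X : DecNGraph F n) : DecNGraph F' n where
  toNGraph := X.toNGraph
  dec := X.dec ≫ f

theorem relabel_rel (e : n ≃ m) {X Y : DecNGraph F n} (h : X ≈ Y) : X.relabel e ≈ Y.relabel e := by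
  obtain ⟨θ, h, h'⟩ := h
  exact ⟨θ, fun j => h _, h'⟩

theorem map_rel (f : F ⟶ F') {X Y : DecNGraph F n} (h : X ≈ Y) : X.map f ≈ Y.map f := by
  obtain ⟨θ, h, h'⟩ := h
  refine ⟨θ, h, ?_⟩
  change _ ≫ (Y.dec ≫ f) = X.dec ≫ f
  rw [← h', Category.assoc]
  rfl

end DecNGraph

/-- The object part of the monad: the colours of `monadObj F` are those of `F`, and its `n`-ary
operations are the isomorphism classes of effective `n`-graphs decorated by `F`.  The port
labelled `j` corresponds to the arc `i (s j)` of the corolla. -/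
def monadObj (F : Species) : Species where
  C := F.C
  inv := F.inv
  inv_inv := F.inv_inv
  Op n _ := Quotient (DecNGraph.setoid F n)
  relabel e := Quotient.map (DecNGraph.relabel e) (fun _ _ h => DecNGraph.relabel_rel e h)
  relabel_refl := by
    rintro n _ ⟨X⟩
    rfl
  relabel_trans := by
    rintro n m k _ _ _ e f ⟨X⟩
    rfl
  col x j := Quotient.lift (fun X : DecNGraph F _ => F.inv (arcOf X.dec (X.port j).1)) (by
    rintro X Y ⟨θ, h, h'⟩
    rw [← h', ← h]
    rfl) x
  col_relabel := by
    rintro n m _ _ e ⟨X⟩ j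
    rfl

/-- The class of a decorated `n`-graph. -/
def opMk {F : Species} {n : Type} [Finite n] (X : DecNGraph F n) : (monadObj F).Op n :=
  Quotient.mk (DecNGraph.setoid F n) X

/-- A decorated `n`-graph representing a given class. -/
noncomputable def opOut {F : Species} {n : Type} [Finite n] (x : (monadObj F).Op n) :
    DecNGraph F n :=
  Quotient.out (s := DecNGraph.setoid F n) x

section monad

set_option linter.unusedSectionVars false

variable {F F' : Species} {G : Graph} {n : Type} [Finite n]

@[simp] theorem opMk_opOut (x : (monadObj F).Op n) : opMk (opOut x) = x :=
  Quotient.out_eq (s := DecNGraph.setoid F n) x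

theorem opMk_eq_iff {X Y : DecNGraph F n} : opMk X = opMk Y ↔ X.Rel Y :=
  Quotient.eq (r := DecNGraph.setoid F n)

theorem opMk_surj (x : (monadObj F).Op n) : ∃ X, opMk X = x := ⟨opOut x, opMk_opOut x⟩

theorem relabel_opMk {m : Type} [Finite m] (e : n ≃ m) (X : DecNGraph F n) :
    (monadObj F).relabel e (opMk X) = opMk (X.relabel e) := rfl

theorem col_opMk (X : DecNGraph F n) (j : n) :
    (monadObj F).col (opMk X) j = F.inv (arcOf X.dec (X.port j).1) := rfl

/-- The monad on morphisms. -/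
noncomputable def monadMap (f : F ⟶ F') : monadObj F ⟶ monadObj F' where
  C := f.C
  onOp := Quotient.map (DecNGraph.map f) (fun _ _ h => DecNGraph.map_rel f h)
  map_inv := f.map_inv
  map_relabel := by
    rintro n m _ _ e ⟨X⟩
    rfl
  map_col := by
    rintro n _ ⟨X⟩ j
    exact (f.map_inv _).symm

theorem monadMap_opMk (f : F ⟶ F') (X : DecNGraph F n) :
    (monadMap f).onOp (opMk X) = opMk (X.map f) := rfl

/-- The underlying endofunctor of the monad. -/
noncomputable def monadFunctor : Species ⥤ Species where
  obj := monadObj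
  map := monadMap
  map_id F := by
    refine Species.hom_ext (fun _ => rfl) ?_
    rintro n _ ⟨X⟩
    rfl
  map_comp f g := by
    refine Species.hom_ext (fun _ => rfl) ?_
    rintro n _ ⟨X⟩
    rfl

/-! #### Multiplication -/

/-- Given a `monadObj F`-graph `φ` on `G`, and representatives `K v` of the classes of decorated
graphs at the vertices, the `F`-graph structure on the graph glued from the `K v`. -/
noncomputable def substDec (φ : toSpecies.obj G ⟶ monadObj F) (K : ∀ v, DecNGraph F (G.Flag v))
    (hK : ∀ v, opMk (K v) = vertOf φ v) :
    toSpecies.obj (glue G (fun v => (K v).toNGraph)) ⟶ F :=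
  glueDec (K := fun v => (K v).toNGraph) (F := F)
    (arcOf (F := monadObj F) φ) (arcOf_i (F := monadObj F) φ) (fun v => (K v).dec)
    (fun v j => by
      have h := col_vertOf φ v j
      rw [← hK v, col_opMk] at h
      rw [← h, F.inv_inv])

theorem arcOf_substDec_inl (φ : toSpecies.obj G ⟶ monadObj F) (K : ∀ v, DecNGraph F (G.Flag v))
    (hK : ∀ v, opMk (K v) = vertOf φ v) (a : G.A) :
    arcOf (substDec φ K hK) (Sum.inl a : GlueA G (fun v => (K v).toNGraph)) = arcOf φ a := rfl

theorem glueIncl_substDec (φ : toSpecies.obj G ⟶ monadObj F) (K : ∀ v, DecNGraph F (G.Flag v))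
    (hK : ∀ v, opMk (K v) = vertOf φ v) (v : G.V) :
    toSpecies.map (glueIncl G (fun v => (K v).toNGraph) v) ≫ substDec φ K hK = (K v).dec :=
  glueIncl_glueDec _ _ _ _ v

/-- Substitution of decorated graphs `K v` into the vertices of an `n`-graph decorated by them. -/
noncomputable def DecNGraph.subst (X : DecNGraph (monadObj F) n)
    (K : ∀ v, DecNGraph F (X.graph.Flag v)) (hK : ∀ v, opMk (K v) = vertOf X.dec v) :
    DecNGraph F n where
  toNGraph := X.toNGraph.subst (fun v => (K v).toNGraph)
  dec := substDec X.dec K hK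

theorem subst_rel {X X' : DecNGraph (monadObj F) n} (h : X.Rel X')
    (K : ∀ v, DecNGraph F (X.graph.Flag v)) (hK : ∀ v, opMk (K v) = vertOf X.dec v)
    (K' : ∀ v, DecNGraph F (X'.graph.Flag v)) (hK' : ∀ v, opMk (K' v) = vertOf X'.dec v) :
    (X.subst K hK).Rel (X'.subst K' hK') := by
  obtain ⟨θ, h, h'⟩ := h
  have key : ∀ v, ∃ κ : (K v).graph ≅ (K' (θ.hom.V v)).graph,
      (∀ j, κ.hom.A ((K v).port j).1 =
        ((K' (θ.hom.V v)).port (Graph.Hom.flagEquiv θ.hom v j)).1) ∧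
      toSpecies.map κ.hom ≫ (K' (θ.hom.V v)).dec = (K v).dec := by
    intro v
    change (K v).Rel ((K' (θ.hom.V v)).relabel (Graph.Hom.flagEquiv θ.hom v).symm)
    rw [← opMk_eq_iff, ← relabel_opMk, hK, hK', ← h', vertOf_map_comp]
  choose κ hκ hκ' using key
  refine ⟨glueIso (K := fun v => (K v).toNGraph) (K' := fun v => (K' v).toNGraph) θ κ hκ,
    fun j => congrArg Sum.inl (h j), ?_⟩
  refine glue_dec_ext (K := fun v => (K v).toNGraph) (fun a => ?_) (fun v => ?_)
  · exact congrArg (fun φ => arcOf φ a) h'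
  · have e1 := glueIncl_substDec X.dec K hK v
    have e2 := glueIncl_substDec X'.dec K' hK' (θ.hom.V v)
    have e3 := glueIncl_glueIso (K := fun v => (K v).toNGraph)
      (K' := fun v => (K' v).toNGraph) θ κ hκ v
    refine Eq.trans ?_ e1.symm
    refine (Category.assoc _ _ _).symm.trans ?_
    refine (congrArg (fun t => t ≫ substDec X'.dec K' hK')
      ((toSpecies.map_comp _ _).symm.trans ((congrArg toSpecies.map e3).trans
        (toSpecies.map_comp _ _)))).trans ?_
    refine (Category.assoc _ _ _).trans ?_
    refine (congrArg (fun t => toSpecies.map (κ v).hom ≫ t) e2).trans ?_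
    exact hκ' v

/-- The multiplication of the monad. -/
noncomputable def mu (F : Species) : monadObj (monadObj F) ⟶ monadObj F where
  C c := c
  onOp {n} _ := Quotient.lift
    (fun X : DecNGraph (monadObj F) n =>
      opMk (X.subst (fun v => opOut (vertOf X.dec v)) (fun _ => opMk_opOut _)))
    (fun X X' h => opMk_eq_iff.2 (subst_rel h _ _ _ _))
  map_inv _ := rfl
  map_relabel := by
    rintro n m _ _ e ⟨X⟩
    rfl
  map_col := by
    rintro n _ ⟨X⟩ j
    rfl

theorem mu_opMk (X : DecNGraph (monadObj F) n) (K : ∀ v, DecNGraph F (X.graph.Flag v))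
    (hK : ∀ v, opMk (K v) = vertOf X.dec v) : (mu F).onOp (opMk X) = opMk (X.subst K hK) :=
  opMk_eq_iff.2 (subst_rel (opMk_eq_iff.1 rfl) _ _ _ _)

theorem mu_naturality (f : F ⟶ F') :
    monadMap (monadMap f) ≫ mu F' = mu F ≫ monadMap f := by
  refine Species.hom_ext (fun _ => rfl) ?_
  intro n _ x
  obtain ⟨X, rfl⟩ := opMk_surj x
  have hK : ∀ v, opMk (opOut (vertOf X.dec v)) = vertOf X.dec v := fun v => opMk_opOut _
  change (mu F').onOp (opMk (X.map (monadMap f))) = (monadMap f).onOp ((mu F).onOp (opMk X))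
  have hK' : ∀ v, opMk ((opOut (vertOf X.dec v)).map f) =
      vertOf (X.map (monadMap f)).dec v := by
    intro v
    rw [← monadMap_opMk, hK]
    rfl
  rw [mu_opMk X _ hK, mu_opMk (X.map (monadMap f)) _ hK', monadMap_opMk, opMk_eq_iff]
  refine ⟨Iso.refl _, fun j => rfl, ?_⟩
  refine glue_dec_ext (fun a => rfl) (fun v => ?_)
  have e1 := glueIncl_substDec X.dec _ hK v
  have e2 := glueIncl_substDec (X.map (monadMap f)).dec _ hK' v
  refine Eq.trans ?_ ((Category.assoc _ _ f).symm.trans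
    ((congrArg (fun t => t ≫ f) e1).trans e2.symm))
  refine congrArg (fun t => toSpecies.map (glueIncl _ _ v) ≫ t) ?_
  exact (congrArg (fun t => t ≫ (substDec X.dec _ hK ≫ f)) (toSpecies.map_id _)).trans
    (Category.id_comp _)

/-! #### Unit -/

/-- The corolla with set of flags `n`. -/
@[reducible]
def corolla (n : Type) [Finite n] : Graph where
  V := Unit
  H := n
  A := n ⊕ n
  i := Sum.swap
  s := Sum.inr
  p _ := ()
  i_i := Sum.swap_swap
  i_ne := by rintro (a | a) <;> simp
  s_inj := Sum.inr_injective

theorem corolla_effective (n : Type) [Finite n] : (corolla n).Effective := by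
  refine ⟨Or.inr ⟨()⟩, ?_⟩
  rintro (a | a)
  · exact Or.inr ⟨a, rfl⟩
  · exact Or.inl ⟨a, rfl⟩

/-- The corolla as an effective `n`-graph. -/
@[reducible]
noncomputable def corollaN (n : Type) [Finite n] : NGraph n where
  graph := corolla n
  eff := corolla_effective n
  port := Equiv.ofBijective (fun j => ⟨(Sum.inl j : n ⊕ n), by rintro ⟨k, hk⟩; cases hk⟩) (by
    constructor
    · intro a b e
      exact Sum.inl.inj (congrArg Subtype.val e)
    · rintro ⟨a | a, h⟩
      · exact ⟨a, rfl⟩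
      · exact absurd ⟨a, rfl⟩ h)

theorem corolla_not_inner (a : (corolla n).A) : ¬ (corolla n).IsInner a := by
  rcases a with a | a
  · rintro ⟨⟨k, hk⟩, -⟩
    cases hk
  · rintro ⟨-, ⟨k, hk⟩⟩
    cases hk

/-- The flags at the vertex of the corolla. -/
def corollaFlag (n : Type) [Finite n] (v : (corolla n).V) : n ≃ (corolla n).Flag v where
  toFun j := ⟨j, rfl⟩
  invFun j := j.1
  left_inv _ := rfl
  right_inv _ := rfl

/-- The corolla decorated by an operation of `F`. -/
noncomputable def corollaDec (x : F.Op n) : DecNGraph F n where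
  toNGraph := corollaN n
  dec := ofLocal (G := corolla n) (Sum.elim (fun j => F.inv (F.col x j)) (F.col x))
    (by
      rintro (a | a)
      · exact (F.inv_inv _).symm
      · rfl)
    (fun v => F.relabel (corollaFlag n v) x) (fun v h => F.col_relabel _ _ _)

theorem vertOf_corollaDec (x : F.Op n) (v : (corolla n).V) :
    vertOf (corollaDec x).dec v = F.relabel (corollaFlag n v) x :=
  F.relabel_refl (n := (corolla n).Flag v) (F.relabel (corollaFlag n v) x)

/-- The unit of the monad. -/
noncomputable def eta (F : Species) : F ⟶ monadObj F where
  C c := c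
  onOp x := opMk (corollaDec x)
  map_inv _ := rfl
  map_relabel {n m} _ _ e x := by
    rw [relabel_opMk, opMk_eq_iff]
    let θ : corolla m ≅ corolla n :=
      isoMk (Equiv.sumCongr e.symm e.symm) e.symm (Equiv.refl _)
        (by rintro (a | a) <;> rfl) (fun _ => rfl) (fun _ => rfl)
    refine ⟨θ, fun _ => rfl, dec_ext ?_ ?_⟩
    · rintro (a | a)
      · exact (congrArg F.inv (F.col_relabel _ _ _)).symm
      · exact (F.col_relabel _ _ _).symm
    · intro v
      refine (vertOf_map_comp _ _ _).trans ?_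
      refine (congrArg (F.relabel _) (vertOf_corollaDec x _)).trans ?_
      refine Eq.trans ?_ (vertOf_corollaDec _ v).symm
      refine (F.relabel_trans (n := n) (m := (corolla n).Flag _) (k := (corolla m).Flag v)
        _ _ x).symm.trans (Eq.trans ?_ (F.relabel_trans (n := n) (m := m)
          (k := (corolla m).Flag v) e _ x))
      refine congrArg (fun e => F.relabel e x) (Equiv.ext fun j => ?_)
      refine (Equiv.symm_apply_eq (Graph.Hom.flagEquiv θ.hom v)).2 (Subtype.ext ?_)
      exact (e.symm_apply_apply j).symm
  map_col x j := F.inv_inv _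

theorem eta_naturality (f : F ⟶ F') : f ≫ eta F' = eta F ≫ monadMap f := by
  refine Species.hom_ext (fun _ => rfl) ?_
  intro n _ x
  change opMk (corollaDec (f.onOp x)) = opMk ((corollaDec x).map f)
  refine congrArg opMk ?_
  refine congrArg (DecNGraph.mk (corollaN n)) (dec_ext ?_ ?_)
  · rintro (a | a)
    · refine (congrArg F'.inv (f.map_col _ _)).trans (f.map_inv _).symm
    · exact f.map_col _ _
  · intro v
    refine (vertOf_corollaDec _ v).trans ?_
    refine (f.map_relabel _ _).symm.trans ?_
    exact congrArg f.onOp (vertOf_corollaDec x v).symm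

/-! #### Monad laws -/

theorem left_unit (F : Species) : eta (monadObj F) ≫ mu F = 𝟙 (monadObj F) := by
  refine Species.hom_ext (fun _ => rfl) ?_
  intro n _ x
  obtain ⟨K, rfl⟩ := opMk_surj x
  change (mu F).onOp (opMk (corollaDec (F := monadObj F) (opMk K))) = opMk K
  have hK : ∀ v, opMk (K.relabel (corollaFlag n v)) =
      vertOf (corollaDec (F := monadObj F) (opMk K)).dec v := fun v =>
    (vertOf_corollaDec (F := monadObj F) (opMk K) v).symm
  rw [mu_opMk _ _ hK, opMk_eq_iff]
  let N : ∀ v, NGraph ((corolla n).Flag v) := fun v => K.toNGraph.relabel (corollaFlag n v)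
  let eA : GlueA (corolla n) N ≃ K.graph.A :=
    { toFun := Sum.elim (Sum.elim (fun j => (K.port j).1) (fun j => K.graph.i (K.port j).1))
        (fun x => x.2.1)
      invFun := glueArc (corolla n) N ()
      left_inv := by
        rintro ((j | j) | ⟨v, a, h⟩)
        · exact glueArc_port (K := N) () (corollaFlag n () j)
        · exact glueArc_i_port (K := N) () (corollaFlag n () j)
        · exact glueArc_inner h
      right_inv := by
        intro a
        rcases (N ()).arc_cases a with ⟨j, rfl⟩ | ⟨j, rfl⟩ | h
        · rw [glueArc_port]
          rfl
        · rw [glueArc_i_port]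
          rfl
        · rw [glueArc_inner h]
          rfl }
  let θ : glue (corolla n) N ≅ K.graph := isoMk eA
    (Equiv.uniqueSigma (fun v : Unit => (N v).graph.H))
    (Equiv.uniqueSigma (fun v : Unit => (N v).graph.V))
    (by
      rintro ((j | j) | ⟨v, a, h⟩)
      · rfl
      · exact (K.graph.i_i _).symm
      · rfl)
    (by
      rintro ⟨v, h⟩
      exact eA.apply_symm_apply _)
    (fun _ => rfl)
  have hθ : glueIncl (corolla n) N () ≫ θ.hom = 𝟙 K.graph :=
    Graph.hom_ext (fun a => eA.apply_symm_apply a) (fun _ => rfl) (fun _ => rfl)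
  refine ⟨θ, fun j => rfl, glue_dec_ext (K := N) ?_ ?_⟩
  · rintro (j | j)
    · exact (F.inv_inv _).symm
    · exact arcOf_i _ _
  · intro v
    refine Eq.trans ?_ (glueIncl_substDec (corollaDec (F := monadObj F) (opMk K)).dec
      (fun v => K.relabel (corollaFlag n v)) hK v).symm
    refine (Category.assoc _ _ _).symm.trans ?_
    refine (congrArg (fun t => t ≫ K.dec) ((toSpecies.map_comp _ _).symm.trans
      ((congrArg toSpecies.map hθ).trans (toSpecies.map_id _)))).trans ?_
    exact Category.id_comp _

theorem right_unit (F : Species) : monadMap (eta F) ≫ mu F = 𝟙 (monadObj F) := by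
  refine Species.hom_ext (fun _ => rfl) ?_
  intro n _ x
  obtain ⟨X, rfl⟩ := opMk_surj x
  change (mu F).onOp (opMk (X.map (eta F))) = opMk X
  have hK : ∀ v, opMk (corollaDec (vertOf X.dec v)) = vertOf (X.map (eta F)).dec v :=
    fun v => rfl
  rw [mu_opMk _ _ hK, opMk_eq_iff]
  let N : ∀ v, NGraph (X.graph.Flag v) := fun v => corollaN _
  have : IsEmpty (Σ v, {a : (N v).graph.A // (N v).graph.IsInner a}) :=
    ⟨fun x => corolla_not_inner _ x.2.2⟩
  let eA : GlueA X.graph N ≃ X.graph.A := Equiv.sumEmpty _ _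
  let eH : (Σ v, X.graph.Flag v) ≃ X.graph.H :=
    { toFun := fun x => x.2.1
      invFun := fun h => ⟨_, h, rfl⟩
      left_inv := by
        rintro ⟨_, h, rfl⟩
        rfl
      right_inv := fun _ => rfl }
  let eV : (Σ _ : X.graph.V, Unit) ≃ X.graph.V :=
    { toFun := fun x => x.1
      invFun := fun v => ⟨v, ()⟩
      left_inv := fun _ => rfl
      right_inv := fun _ => rfl }
  let θ : glue X.graph N ≅ X.graph := isoMk eA eH eV
    (by
      rintro (a | a)
      · rfl
      · exact isEmptyElim a)
    (by
      rintro ⟨v, h⟩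
      exact congrArg eA (glueArc_i_port (K := N) v h))
    (by
      rintro ⟨v, h⟩
      exact h.2.symm)
  refine ⟨θ, fun j => rfl, glue_dec_ext (K := N) (fun a => rfl) ?_⟩
  intro v
  refine Eq.trans ?_ (glueIncl_substDec (X.map (eta F)).dec
      (fun v => corollaDec (vertOf X.dec v)) hK v).symm
  refine dec_ext ?_ ?_
  · rintro (j | j)
    · change arcOf X.dec (eA (glueArc X.graph N v ((N v).port j).1)) = F.inv (F.col _ j)
      rw [glueArc_port, col_vertOf]
      exact arcOf_i _ _
    · change arcOf X.dec (eA (glueArc X.graph N v ((N v).graph.i ((N v).port j).1))) = F.col _ j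
      rw [glueArc_i_port, col_vertOf]
      rfl
  · intro w
    refine Eq.trans ?_ (vertOf_corollaDec (vertOf X.dec v) w).symm
    refine (vertOf_map_comp (glueIncl X.graph N v) (toSpecies.map θ.hom ≫ X.dec) w).trans ?_
    refine (congrArg (F.relabel _) (vertOf_map_comp θ.hom X.dec _)).trans ?_
    refine (F.relabel_trans (n := X.graph.Flag v) (m := (glue X.graph N).Flag ⟨v, w⟩)
      (k := (corolla (X.graph.Flag v)).Flag w) _ _ _).symm.trans ?_
    refine congrArg (fun e => F.relabel e (vertOf X.dec v)) (Equiv.ext fun j => ?_)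
    exact (Equiv.symm_apply_eq (Graph.Hom.flagEquiv (glueIncl X.graph N v) w)).2
      ((Equiv.symm_apply_eq (Graph.Hom.flagEquiv θ.hom _)).2 rfl)

section assoc

variable (G : Graph) (K : ∀ v, NGraph (G.Flag v))
  (L : ∀ v w, NGraph ((K v).graph.Flag w))

/-- The family `L`, indexed by the vertices of the glued graph. -/
@[reducible]
noncomputable def assocFam (x : (glue G K).V) : NGraph ((glue G K).Flag x) :=
  (L x.1 x.2).relabel (Graph.Hom.flagEquiv (glueIncl G K x.1) x.2)

/-- The bijection on arcs expressing that gluing is associative. -/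
noncomputable def assocA : GlueA G (fun v => (K v).subst (L v)) ≃
    GlueA (glue G K) (assocFam G K L) where
  toFun
    | Sum.inl a => Sum.inl (Sum.inl a)
    | Sum.inr ⟨v, ⟨Sum.inl b, h⟩⟩ => Sum.inl (Sum.inr ⟨v, b, (isInner_inl_iff b).1 h⟩)
    | Sum.inr ⟨v, ⟨Sum.inr ⟨w, c⟩, _⟩⟩ => Sum.inr ⟨⟨v, w⟩, c⟩
  invFun
    | Sum.inl (Sum.inl a) => Sum.inl a
    | Sum.inl (Sum.inr ⟨v, b, h⟩) => Sum.inr ⟨v, ⟨Sum.inl b, (isInner_inl_iff b).2 h⟩⟩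
    | Sum.inr ⟨⟨v, w⟩, c⟩ => Sum.inr ⟨v, ⟨Sum.inr ⟨w, c⟩, isInner_inr _⟩⟩
  left_inv := by
    rintro (a | ⟨v, ⟨b | ⟨w, c⟩, h⟩⟩) <;> rfl
  right_inv := by
    rintro ((a | ⟨v, b, h⟩) | ⟨⟨v, w⟩, c⟩) <;> rfl

theorem assocA_glueArc_inl (v : G.V) (b : (K v).graph.A) :
    assocA G K L (glueArc G (fun v => (K v).subst (L v)) v
      (Sum.inl b : GlueA (K v).graph (L v))) = Sum.inl (glueArc G K v b) := by
  rcases (K v).arc_cases b with ⟨j, rfl⟩ | ⟨j, rfl⟩ | h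
  · rw [glueArc_port]
    exact congrArg (assocA G K L) (glueArc_port (K := fun v => (K v).subst (L v)) v j)
  · rw [glueArc_i_port]
    exact congrArg (assocA G K L) (glueArc_i_port (K := fun v => (K v).subst (L v)) v j)
  · rw [glueArc_inner h, glueArc_inner ((isInner_inl_iff b).2 h)]
    rfl

theorem assocA_glueArc (v : G.V) (w : (K v).graph.V) (a : (L v w).graph.A) :
    assocA G K L (glueArc G (fun v => (K v).subst (L v)) v (glueArc (K v).graph (L v) w a)) =
      glueArc (glue G K) (assocFam G K L) ⟨v, w⟩ a := by
  rcases (assocFam G K L ⟨v, w⟩).arc_cases a with ⟨j, rfl⟩ | ⟨j, rfl⟩ | h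
  · obtain ⟨j, rfl⟩ := (Graph.Hom.flagEquiv (glueIncl G K v) w).surjective j
    refine Eq.trans ?_ (glueArc_port (K := assocFam G K L) ⟨v, w⟩ _).symm
    have e : (assocFam G K L ⟨v, w⟩).port (Graph.Hom.flagEquiv (glueIncl G K v) w j) =
        (L v w).port j := congrArg (L v w).port (Equiv.symm_apply_apply _ _)
    rw [e, glueArc_port, assocA_glueArc_inl, glueArc_i]
    rfl
  · obtain ⟨j, rfl⟩ := (Graph.Hom.flagEquiv (glueIncl G K v) w).surjective j
    refine Eq.trans ?_ (glueArc_i_port (K := assocFam G K L) ⟨v, w⟩ _).symm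
    have e : (assocFam G K L ⟨v, w⟩).port (Graph.Hom.flagEquiv (glueIncl G K v) w j) =
        (L v w).port j := congrArg (L v w).port (Equiv.symm_apply_apply _ _)
    rw [e]
    refine (congrArg (fun t => assocA G K L (glueArc G (fun v => (K v).subst (L v)) v t))
      (glueArc_i_port (K := L v) w j)).trans ?_
    exact assocA_glueArc_inl G K L v _
  · have h' : (L v w).graph.IsInner a := h
    rw [glueArc_inner h']
    refine Eq.trans ?_ (glueArc_inner (K := assocFam G K L) (v := ⟨v, w⟩) h).symm
    rw [glueArc_inner (isInner_inr _)]
    rfl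

/-- Gluing is associative. -/
noncomputable def glueAssoc :
    glue G (fun v => (K v).subst (L v)) ≅ glue (glue G K) (assocFam G K L) :=
  isoMk (assocA G K L)
    (Equiv.sigmaAssoc (fun v (w : (K v).graph.V) => (L v w).graph.H)).symm
    (Equiv.sigmaAssoc (fun v (w : (K v).graph.V) => (L v w).graph.V)).symm
    (by
      rintro (a | ⟨v, ⟨b | ⟨w, c⟩, h⟩⟩) <;> rfl)
    (by
      rintro ⟨v, w, h⟩
      exact assocA_glueArc G K L v w _)
    (fun _ => rfl)

end assoc

theorem map_map_map {G₁ G₂ G₃ G₄ : Graph} {F : Species} (f : G₁ ⟶ G₂) (g : G₂ ⟶ G₃) (h : G₃ ⟶ G₄)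
    (φ : toSpecies.obj G₄ ⟶ F) :
    toSpecies.map f ≫ toSpecies.map g ≫ toSpecies.map h ≫ φ = toSpecies.map (f ≫ g ≫ h) ≫ φ := by
  simp

theorem mu_assoc (F : Species) : monadMap (mu F) ≫ mu F = mu (monadObj F) ≫ mu F := by
  refine Species.hom_ext (fun _ => rfl) ?_
  intro n _ x
  obtain ⟨X, rfl⟩ := opMk_surj x
  change (mu F).onOp (opMk (X.map (mu F))) = (mu F).onOp ((mu (monadObj F)).onOp (opMk X))
  let K : ∀ v, DecNGraph (monadObj F) (X.graph.Flag v) := fun v => opOut (vertOf X.dec v)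
  have hK : ∀ v, opMk (K v) = vertOf X.dec v := fun v => opMk_opOut _
  let L : ∀ v w, DecNGraph F ((K v).graph.Flag w) := fun v w => opOut (vertOf (K v).dec w)
  have hL : ∀ v w, opMk (L v w) = vertOf (K v).dec w := fun v w => opMk_opOut _
  have h1 : ∀ v, opMk ((K v).subst (L v) (hL v)) = vertOf (X.map (mu F)).dec v := fun v =>
    (mu_opMk (K v) (L v) (hL v)).symm.trans (congrArg (mu F).onOp (hK v))
  have h2 : ∀ x : (X.subst K hK).graph.V,
      opMk (n := (X.subst K hK).graph.Flag x) ((L x.1 x.2).relabel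
        (Graph.Hom.flagEquiv (glueIncl X.graph (fun v => (K v).toNGraph) x.1) x.2)) =
        vertOf (X.subst K hK).dec x := by
    rintro ⟨v, w⟩
    refine (relabel_opMk _ _).symm.trans ?_
    have e := congrArg (fun φ => vertOf φ w) (glueIncl_substDec X.dec K hK v)
    refine (congrArg ((monadObj F).relabel _) ((hL v w).trans (e.symm.trans
      (vertOf_map_comp _ _ _)))).trans ?_
    refine ((monadObj F).relabel_trans _ _ _).symm.trans ?_
    refine (congrArg (fun e => (monadObj F).relabel e _) (Equiv.symm_trans_self _)).trans ?_
    exact (monadObj F).relabel_refl _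
  rw [mu_opMk (X.map (mu F)) (fun v => (K v).subst (L v) (hL v)) h1, mu_opMk X K hK,
    mu_opMk (X.subst K hK) _ h2, opMk_eq_iff]
  let N : ∀ v, NGraph (X.graph.Flag v) := fun v => (K v).toNGraph
  let M : ∀ v w, NGraph ((N v).graph.Flag w) := fun v w => (L v w).toNGraph
  let P := ((X.subst K hK).subst _ h2).dec
  refine ⟨glueAssoc X.graph N M, fun j => rfl,
    glue_dec_ext (K := fun v => (N v).subst (M v)) (fun a => rfl) (fun v => ?_)⟩
  refine Eq.trans ?_ (glueIncl_substDec (X.map (mu F)).dec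
    (fun v => (K v).subst (L v) (hL v)) h1 v).symm
  refine glue_dec_ext (K := M v) (fun b => ?_) (fun w => ?_)
  · change arcOf P (assocA X.graph N M (glueArc X.graph (fun v => (N v).subst (M v)) v
      (Sum.inl b : GlueA (N v).graph (M v)))) = arcOf (K v).dec b
    rw [assocA_glueArc_inl]
    exact congrArg (fun φ => arcOf φ b) (glueIncl_substDec X.dec K hK v)
  · refine Eq.trans ?_ (glueIncl_substDec (K v).dec (L v) (hL v) w).symm
    have e : glueIncl (N v).graph (M v) w ≫ glueIncl X.graph (fun v => (N v).subst (M v)) v ≫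
        (glueAssoc X.graph N M).hom = glueIncl (glue X.graph N) (assocFam X.graph N M) ⟨v, w⟩ :=
      Graph.hom_ext (fun a => assocA_glueArc X.graph N M v w a) (fun _ => rfl) (fun _ => rfl)
    have e' := congrArg (fun f => toSpecies.map f ≫ P) e
    refine Eq.trans ?_ (e'.trans (glueIncl_substDec (X.subst K hK).dec _ h2 ⟨v, w⟩))
    exact map_map_map _ _ _ P

/-- The monad on graphical species. -/
noncomputable def speciesMonad : Monad Species where
  toFunctor := monadFunctor
  η := { app := eta, naturality := fun _ _ f => eta_naturality f }
  μ := { app := mu, naturality := fun _ _ f => mu_naturality f }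
  assoc := mu_assoc
  left_unit := left_unit
  right_unit := right_unit

end monad

/-! ### The restricted Kleisli category -/

/-- A graph without isolated edges. -/
structure KGraph : Type 1 where
  graph : Graph
  noIsolatedEdges : graph.NoIsolatedEdges

/-- The restricted Kleisli category: the full subcategory of the Kleisli category of the monad
`speciesMonad` on the graphs without isolated edges. -/
abbrev RestrictedKleisli : Type 1 :=
  InducedCategory (Kleisli speciesMonad)
    (fun R : KGraph => Kleisli.mk speciesMonad (toSpecies.obj R.graph))

namespace RestrictedKleisli

/-- The underlying graph. -/
abbrev graph (R : RestrictedKleisli) : Graph := KGraph.graph R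

/-- The morphism of graphical species underlying a morphism of the restricted Kleisli category. -/
def toHom {R Y : RestrictedKleisli} (φ : R ⟶ Y) :
    toSpecies.obj R.graph ⟶ monadObj (toSpecies.obj Y.graph) :=
  φ.hom.of

/-- The free morphism on an etale morphism: its image under the canonical functor to the Kleisli
category. -/
noncomputable def free {R Y : RestrictedKleisli} (f : R.graph ⟶ Y.graph) : R ⟶ Y :=
  InducedCategory.homMk ((Kleisli.Adjunction.toKleisli speciesMonad).map (toSpecies.map f))

/-- A morphism of the restricted Kleisli category is a reduced cover if it is the free morphism on
an etale morphism that is a reduced cover. -/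
def IsReducedCover {R Y : RestrictedKleisli} (φ : R ⟶ Y) : Prop :=
  ∃ f : R.graph ⟶ Y.graph, Graph.Hom.IsReducedCover f ∧ φ = free f

/-- The graphs `S_x` over `Y` that a morphism `R ⟶ Y` assigns to the vertices `x` of `R`. -/
noncomputable def vertexGraph {R Y : RestrictedKleisli} (φ : R ⟶ Y) (x : R.graph.V) :
    DecNGraph (toSpecies.obj Y.graph) (R.graph.Flag x) :=
  opOut (vertOf (toHom φ) x)

/-- The colimit graph of a morphism `R ⟶ Y`: the graph obtained by gluing the graphs `S_x`
according to `R`. -/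
noncomputable def colimGraph {R Y : RestrictedKleisli} (φ : R ⟶ Y) : Graph :=
  glue R.graph (fun x => (vertexGraph φ x).toNGraph)

/-- The structure of a graph over `Y` on the colimit graph. -/
noncomputable def colimDec {R Y : RestrictedKleisli} (φ : R ⟶ Y) :
    toSpecies.obj (colimGraph φ) ⟶ toSpecies.obj Y.graph :=
  substDec (toHom φ) (vertexGraph φ) (fun _ => opMk_opOut _)

/-- A morphism `R ⟶ Y` is generic if the etale morphism from its colimit graph to `Y` is
invertible. -/
def IsGeneric {R Y : RestrictedKleisli} (φ : R ⟶ Y) : Prop :=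
  ∃ e : colimGraph φ ≅ Y.graph, toSpecies.map e.hom = colimDec φ

end RestrictedKleisli

end KockGraph

/-! A reduced cover is bijective on vertices: if two vertices had the same image, one of them could
be deleted together with its flags (`Hom.IsReducedCover.injective_V`). Conversely, when the domain
has no isolated edges, an etale morphism bijective on vertices and surjective on arcs is a reduced
cover (`Hom.isReducedCover_of_bijective`). So `r` merely identifies some arcs of `R`, while by
genericity `S` is, up to isomorphism, the gluing along `R` of graphs `K v`.

The pushout is the gluing of the same graphs along `R'`, each `K v` being moved to the vertex `r v`.
The morphism from `R'` is the canonical one, which is generic (`isGeneric_toGlue`). The morphism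
from `S` is induced by functoriality of gluing (`glueMap`); it is again bijective on vertices and
surjective on arcs, hence a reduced cover.

For the universal property, free morphisms on covers are epimorphisms (`free_cancel`), which gives
uniqueness. For existence, a decoration of `S` descends to the pushout as soon as arcs with the same
image have the same colour, the vertices imposing no condition (`exists_descend`). The only arcs
that become identified are arcs of `R` that `r` identifies (`glueMapA_eq`), and the commuting square
expresses their colours through the given morphism on `R'`.

It remains to pass to an arbitrary pushout. The comparison isomorphism in the Kleisli category is
free on an isomorphism of graphs (`exists_iso_eq_free`): substitution never destroys vertices or
inner edges, so a composite that is an identity can only assign corollas. Both properties are stable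
under composition with isomorphisms of graphs. -/

namespace KockGraph

open KockGraph.Graph KockGraph.Species

/-! ### Etale morphisms and a criterion for reduced covers -/

namespace Graph

variable {G X : Graph}

/-- By the pullback condition, a flag is determined by its vertex and its image. -/
theorem Hom.H_injective (f : G ⟶ X) (hV : Function.Injective f.V) : Function.Injective f.H := by
  intro a b e
  have hab : G.p a = G.p b := hV (by rw [f.map_p, f.map_p, e])
  exact (f.pullback (G.p b) (f.H b) (f.map_p b).symm).unique ⟨hab, e⟩ ⟨rfl, rfl⟩

theorem Hom.H_surjective (f : G ⟶ X) (hV : Function.Surjective f.V) :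
    Function.Surjective f.H := by
  intro h
  obtain ⟨v, hv⟩ := hV (X.p h)
  obtain ⟨k, ⟨-, hk⟩, -⟩ := f.pullback v h hv.symm
  exact ⟨k, hk⟩

/-- An etale morphism that is bijective on vertices and on arcs is an isomorphism. -/
noncomputable def isoOfBijective (f : G ⟶ X) (hV : Function.Bijective f.V)
    (hA : Function.Bijective f.A) : G ≅ X :=
  isoMk (Equiv.ofBijective f.A hA)
    (Equiv.ofBijective f.H ⟨Hom.H_injective f hV.1, Hom.H_surjective f hV.2⟩)
    (Equiv.ofBijective f.V hV) f.map_i f.map_s f.map_p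

/-- Two etale morphisms that agree on vertices and on arcs are equal. -/
theorem hom_ext_of_A_V {f g : G ⟶ X} (hA : ∀ a, f.A a = g.A a) (hV : ∀ v, f.V v = g.V v) :
    f = g :=
  hom_ext hA (fun h => X.s_inj (by rw [← f.map_s, ← g.map_s, hA])) hV

variable (G) in
/-- The subgraph of `G` obtained by removing the vertex `v` and the flags at `v`. -/
@[reducible]
def removeVertex (v : G.V) : Graph where
  V := {w : G.V // w ≠ v}
  H := {h : G.H // G.p h ≠ v}
  A := G.A
  i := G.i
  s h := G.s h.1
  p h := ⟨G.p h.1, h.2⟩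
  i_i := G.i_i
  i_ne := G.i_ne
  s_inj := G.s_inj.comp Subtype.val_injective

variable (G) in
/-- The inclusion of the complement of a vertex. -/
def removeVertexIncl (v : G.V) : G.removeVertex v ⟶ G where
  A a := a
  H h := h.1
  V w := w.1
  map_i _ := rfl
  map_s _ := rfl
  map_p _ := rfl
  pullback := by
    rintro ⟨w, hw⟩ h e
    have e' : G.p h = w := e
    subst e'
    exact ⟨⟨h, hw⟩, ⟨rfl, rfl⟩, fun y hy => Subtype.ext hy.2⟩

/-- Of two vertices with the same image, one is superfluous. Its complement keeps all the arcs, so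
it still covers, although its inclusion misses a vertex. -/
theorem Hom.IsReducedCover.injective_V {f : G ⟶ X} (hf : Hom.IsReducedCover f) :
    Function.Injective f.V := by
  intro v w e
  by_contra hne
  have := hf.2 _ (G.removeVertexIncl w)
    ⟨fun _ _ h => h, Subtype.val_injective, Subtype.val_injective⟩
    ⟨fun x => by
      obtain ⟨y, rfl⟩ := hf.1.1 x
      by_cases hy : y = w
      · subst hy
        exact ⟨⟨v, hne⟩, e⟩
      · exact ⟨⟨y, hy⟩, rfl⟩, hf.1.2⟩
  obtain ⟨y, hy⟩ := (equivV (asIso (G.removeVertexIncl w))).surjective w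
  exact y.2 hy

/-- A subgraph that still covers contains every vertex, hence every flag by the pullback condition,
hence every arc, since each arc or its opposite carries a flag. An isolated edge would escape this
argument: it could be dropped if its image were hit elsewhere. -/
theorem Hom.isReducedCover_of_bijective (hG : G.NoIsolatedEdges) {f : G ⟶ X}
    (hV : Function.Bijective f.V) (hA : Function.Surjective f.A) : Hom.IsReducedCover f := by
  refine ⟨⟨hV.2, hA⟩, fun U u hu hc => ?_⟩
  have huV : Function.Surjective u.V := fun v => by
    obtain ⟨w, hw⟩ := hc.1 (f.V v)
    exact ⟨w, hV.1 hw⟩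
  have huA : Function.Surjective u.A := fun a => by
    rcases hG a with ⟨h, hh⟩ | ⟨h, hh⟩
    · obtain ⟨k, rfl⟩ := Hom.H_surjective u huV h
      exact ⟨U.s k, by rw [u.map_s, hh]⟩
    · obtain ⟨k, rfl⟩ := Hom.H_surjective u huV h
      exact ⟨U.i (U.s k), by rw [u.map_i, u.map_s, hh, G.i_i]⟩
  exact (isoOfBijective u ⟨hu.2.2, huV⟩ ⟨hu.1, huA⟩).isIso_hom

theorem Effective.nonempty_V (hG : G.Effective) : Nonempty G.V := by
  rcases hG.1 with ⟨⟨a⟩⟩ | h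
  · rcases hG.2 a with ⟨h, -⟩ | ⟨h, -⟩ <;> exact ⟨G.p h⟩
  · exact h

end Graph

/-! ### Decorations as morphisms -/

section species

variable {G X : Graph} {F : Species}

/-- The etale morphism underlying a morphism of the represented graphical species. -/
noncomputable def graphHom (φ : toSpecies.obj G ⟶ toSpecies.obj X) : G ⟶ X where
  A a := (arcOf φ a).down
  V v := (vertOf φ v).down.1
  H h := ((vertOf φ (G.p h)).down.2 ⟨h, rfl⟩).1
  map_i a := congrArg ULift.down (arcOf_i φ a)
  map_s h := (congrArg ULift.down (col_vertOf φ (G.p h) ⟨h, rfl⟩)).symm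
  map_p h := ((vertOf φ (G.p h)).down.2 ⟨h, rfl⟩).2.symm
  pullback v h e := by
    refine ⟨((vertOf φ v).down.2.symm ⟨h, e⟩).1, ⟨((vertOf φ v).down.2.symm ⟨h, e⟩).2, ?_⟩, ?_⟩
    -- `H` reads the operation at `G.p k`, not at `v`; eliminating the equation carried by the flag
    -- `k` makes the two coincide.
    · generalize hk : (vertOf φ v).down.2.symm ⟨h, e⟩ = k
      obtain ⟨k, rfl⟩ := k
      exact congrArg Subtype.val ((Equiv.symm_apply_eq _).1 hk).symm
    · rintro y ⟨rfl, rfl⟩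
      exact congrArg Subtype.val (((Equiv.symm_apply_eq _).2 (Subtype.ext rfl)).symm :
        (⟨y, rfl⟩ : G.Flag (G.p y)) = _)

/-- Fullness of the embedding: an operation of `X` is a vertex with a labelling of its flags, and
the labellings being bijective is the pullback condition. -/
theorem map_graphHom (φ : toSpecies.obj G ⟶ toSpecies.obj X) :
    toSpecies.map (graphHom φ) = φ := by
  refine dec_ext (fun a => rfl) (fun v => ?_)
  refine congrArg ULift.up (congrArg (Sigma.mk (vertOf φ v).down.1) (Equiv.ext ?_))
  rintro ⟨h, rfl⟩
  rfl

theorem relabel_flagEquiv_vertOf (f : G ⟶ X) (φ : toSpecies.obj X ⟶ F) (v : G.V) :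
    F.relabel (Graph.Hom.flagEquiv f v) (vertOf (toSpecies.map f ≫ φ) v) = vertOf φ (f.V v) := by
  rw [vertOf_map_comp, ← F.relabel_trans, Equiv.symm_trans_self, F.relabel_refl]

/-- An `F`-graph is determined by its restriction along a cover. -/
theorem dec_ext_of_cover {f : G ⟶ X} (hf : Hom.IsCover f) {φ ψ : toSpecies.obj X ⟶ F}
    (h : toSpecies.map f ≫ φ = toSpecies.map f ≫ ψ) : φ = ψ := by
  refine dec_ext (fun a => ?_) (fun v => ?_)
  · obtain ⟨a, rfl⟩ := hf.2 a
    exact congrArg (fun χ => arcOf χ a) h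
  · obtain ⟨v, rfl⟩ := hf.1 v
    rw [← relabel_flagEquiv_vertOf, ← relabel_flagEquiv_vertOf, h]

/-- A family over the domain of a bijection, transported to the codomain. -/
theorem exists_family {α β : Type*} {f : α → β} (hf : Function.Bijective f) {P : β → Type*}
    (d : ∀ a, P (f a)) : ∃ d' : ∀ b, P b, ∀ a, d' (f a) = d a :=
  ⟨Equiv.piCongrLeft P (Equiv.ofBijective f hf) d,
    fun a => Equiv.piCongrLeft_apply_apply P (Equiv.ofBijective f hf) d a⟩

/-- `F`-graphs descend along etale morphisms that are bijective on vertices and surjective on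
arcs, as soon as the colours of the arcs do. -/
theorem exists_descend {f : G ⟶ X} (hV : Function.Bijective f.V) (hA : Function.Surjective f.A)
    (ψ : toSpecies.obj G ⟶ F) (h : ∀ a b, f.A a = f.A b → arcOf ψ a = arcOf ψ b) :
    ∃ φ : toSpecies.obj X ⟶ F, toSpecies.map f ≫ φ = ψ := by
  -- Exactly one vertex of `G` lies over each vertex of `X`, so the operation there is forced and
  -- meets no compatibility condition.
  obtain ⟨d, hd⟩ := exists_family (P := fun v => F.Op (X.Flag v)) hV
    (fun v => F.relabel (Graph.Hom.flagEquiv f v) (vertOf ψ v))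
  -- The colour is read at an arbitrary preimage; `h` makes it independent of the choice.
  let c : X.A → F.C := fun a => arcOf ψ (Function.surjInv hA a)
  have hc : ∀ a, c (f.A a) = arcOf ψ a := fun a => h _ _ (Function.surjInv_eq hA _)
  refine ⟨ofLocal c ?_ d ?_, dec_ext (fun a => hc a) (fun v => ?_)⟩
  · intro a
    obtain ⟨a, rfl⟩ := hA a
    rw [← f.map_i, hc, hc, arcOf_i]
  · intro v k
    obtain ⟨v, rfl⟩ := hV.2 v
    obtain ⟨k, rfl⟩ := (Graph.Hom.flagEquiv f v).surjective k
    rw [hd, F.col_relabel, Equiv.symm_apply_apply, col_vertOf, flagEquiv_val, ← f.map_s, hc]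
  · rw [vertOf_map_comp, vertOf_ofLocal, hd, ← F.relabel_trans, Equiv.self_trans_symm,
      F.relabel_refl]

end species

/-! ### Functoriality of gluing -/

section glueMap

variable {G G' : Graph} {K : ∀ v, NGraph (G.Flag v)} {K' : ∀ v, NGraph (G'.Flag v)}
  (θ : G ⟶ G') (κ : ∀ v, (K v).graph ≅ (K' (θ.V v)).graph)
  (hκ : ∀ v j, (κ v).hom.A ((K v).port j).1 =
    ((K' (θ.V v)).port (Graph.Hom.flagEquiv θ v j)).1)

/-- The map on arcs of the glued graphs induced by an etale morphism of the underlying graphs and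
isomorphisms of the glued pieces. -/
def glueMapA : GlueA G K → GlueA G' K' :=
  Sum.map θ.A (fun x => ⟨θ.V x.1, (κ x.1).hom.A x.2.1, (isInner_iso (κ x.1) x.2.1).1 x.2.2⟩)

/-- On inner arcs the two sides agree by definition; on ports and their opposites, which are glued
to arcs of `G`, the agreement is the compatibility `hκ` with the labels. -/
theorem glueMapA_glueArc (hκ : ∀ v j, (κ v).hom.A ((K v).port j).1 =
    ((K' (θ.V v)).port (Graph.Hom.flagEquiv θ v j)).1) (v : G.V) (a : (K v).graph.A) :
    glueMapA θ κ (glueArc G K v a) = glueArc G' K' (θ.V v) ((κ v).hom.A a) := by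
  rcases (K v).arc_cases a with ⟨j, rfl⟩ | ⟨j, rfl⟩ | h
  · rw [hκ, glueArc_port, glueArc_port]
    exact congrArg Sum.inl ((θ.map_i _).trans (congrArg G'.i (θ.map_s _)))
  · rw [(κ v).hom.map_i, hκ, glueArc_i_port, glueArc_i_port]
    exact congrArg Sum.inl (θ.map_s _)
  · rw [glueArc_inner h, glueArc_inner ((isInner_iso (κ v) a).1 h)]
    rfl

/-- Gluing is functorial for etale morphisms of the underlying graphs and isomorphisms of the
glued pieces. -/
noncomputable def glueMap : glue G K ⟶ glue G' K' where
  A := glueMapA θ κ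
  H x := ⟨θ.V x.1, (κ x.1).hom.H x.2⟩
  V x := ⟨θ.V x.1, (κ x.1).hom.V x.2⟩
  map_i := by
    rintro (a | ⟨v, a, h⟩)
    · exact congrArg Sum.inl (θ.map_i a)
    · exact congrArg Sum.inr (congrArg (Sigma.mk _) (Subtype.ext ((κ v).hom.map_i a)))
  map_s := by
    rintro ⟨v, h⟩
    refine (glueMapA_glueArc θ κ hκ v _).trans ?_
    exact congrArg (glueArc G' K' (θ.V v)) ((κ v).hom.map_s h)
  map_p := by
    rintro ⟨v, h⟩
    exact congrArg (Sigma.mk _) ((κ v).hom.map_p h)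
  pullback := by
    rintro ⟨v, w⟩ ⟨v', h⟩ e
    obtain ⟨e₁, e₂⟩ := Sigma.mk.inj e
    dsimp only at e₁
    subst e₁
    obtain ⟨k, ⟨hk, hk'⟩, -⟩ := (κ v).hom.pullback w h (eq_of_heq e₂)
    refine ⟨⟨v, k⟩, ⟨congrArg (Sigma.mk v) hk, congrArg (Sigma.mk _) hk'⟩, ?_⟩
    rintro ⟨v₂, k₂⟩ ⟨h₁, h₂⟩
    obtain ⟨e₃, -⟩ := Sigma.mk.inj h₁
    dsimp only at e₃
    subst e₃
    refine congrArg (Sigma.mk _) ((equivH (κ v₂)).injective ?_)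
    exact (eq_of_heq (Sigma.mk.inj h₂).2).trans hk'.symm

theorem glueIncl_glueMap (v : G.V) :
    glueIncl G K v ≫ glueMap θ κ hκ = (κ v).hom ≫ glueIncl G' K' (θ.V v) :=
  Graph.hom_ext (fun a => glueMapA_glueArc θ κ hκ v a) (fun _ => rfl) (fun _ => rfl)

theorem glueMap_bijective_V (hθ : Function.Bijective θ.V) :
    Function.Bijective (glueMap θ κ hκ).V :=
  (Equiv.sigmaCongr (Equiv.ofBijective _ hθ) (fun v => equivV (κ v)) :
    (Σ v, (K v).graph.V) ≃ Σ v, (K' v).graph.V).bijective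

theorem glueMap_surjective_A (hV : Function.Surjective θ.V) (hA : Function.Surjective θ.A) :
    Function.Surjective (glueMap θ κ hκ).A := by
  rintro (a | ⟨v, a, h⟩)
  · obtain ⟨a, rfl⟩ := hA a
    exact ⟨(Sum.inl a : GlueA G K), rfl⟩
  · obtain ⟨v, rfl⟩ := hV v
    obtain ⟨a, rfl⟩ := (equivA (κ v)).surjective a
    exact ⟨(Sum.inr ⟨v, a, (isInner_iso (κ v) a).2 h⟩ : GlueA G K), rfl⟩

/-- Distinct pieces go to distinct pieces, each isomorphically, so all identifications take place
among the arcs of `G`. This reduces descent along `glueMap` to a condition on `θ`. -/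
theorem glueMapA_eq (hV : Function.Injective θ.V) {x y : GlueA G K}
    (e : glueMapA θ κ x = glueMapA θ κ y) :
    x = y ∨ ∃ a b, x = Sum.inl a ∧ y = Sum.inl b ∧ θ.A a = θ.A b := by
  rcases x with a | ⟨v, a, ha⟩ <;> rcases y with b | ⟨w, b, hb⟩
  · exact Or.inr ⟨a, b, rfl, rfl, Sum.inl.inj e⟩
  · cases e
  · cases e
  · obtain ⟨e₁, e₂⟩ := Sigma.mk.inj (Sum.inr.inj e)
    obtain rfl := hV e₁
    have := (equivA (κ v)).injective (congrArg Subtype.val (eq_of_heq e₂))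
    subst this
    exact Or.inl rfl

end glueMap

/-- Two representatives of a class are isomorphic compatibly with the port labels, so these
isomorphisms glue over the identity of `G`. This frees genericity from the chosen representatives in
`vertexGraph`. -/
theorem exists_iso_substDec {F : Species} {G : Graph} (φ : toSpecies.obj G ⟶ monadObj F)
    (K K' : ∀ v, DecNGraph F (G.Flag v)) (hK : ∀ v, opMk (K v) = vertOf φ v)
    (hK' : ∀ v, opMk (K' v) = vertOf φ v) :
    ∃ α : glue G (fun v => (K v).toNGraph) ≅ glue G (fun v => (K' v).toNGraph),
      toSpecies.map α.hom ≫ substDec φ K' hK' = substDec φ K hK := by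
  have key : ∀ v, (K v).Rel (K' v) := fun v => opMk_eq_iff.1 ((hK v).trans (hK' v).symm)
  choose κ hκ hκ' using key
  have hκ₂ : ∀ v j, (κ v).hom.A ((K v).port j).1 =
      ((K' v).port (Graph.Hom.flagEquiv (Iso.refl G).hom v j)).1 := hκ
  refine ⟨glueIso (K := fun v => (K v).toNGraph) (K' := fun v => (K' v).toNGraph)
    (Iso.refl G) κ hκ₂, glue_dec_ext (K := fun v => (K v).toNGraph) (fun a => rfl) (fun v => ?_)⟩
  have e₁ := glueIncl_substDec φ K hK v
  have e₂ := glueIncl_substDec φ K' hK' v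
  have e₃ := glueIncl_glueIso (K := fun v => (K v).toNGraph)
    (K' := fun v => (K' v).toNGraph) (Iso.refl G) κ hκ₂ v
  rw [e₁, ← Category.assoc, ← toSpecies.map_comp, e₃, toSpecies.map_comp, Category.assoc]
  exact (congrArg (fun t => toSpecies.map (κ v).hom ≫ t) e₂).trans (hκ' v)

/-! ### Composition with free morphisms, and genericity -/

namespace RestrictedKleisli

variable {X Y Z : RestrictedKleisli}

theorem hom_ext_toHom {φ ψ : X ⟶ Y} (h : toHom φ = toHom ψ) : φ = ψ :=
  InducedCategory.hom_ext (Kleisli.hom_ext h)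

/-- The morphism of the restricted Kleisli category given by a morphism of graphical species. -/
noncomputable def ofHom (φ : toSpecies.obj X.graph ⟶ monadObj (toSpecies.obj Y.graph)) : X ⟶ Y :=
  InducedCategory.homMk (Kleisli.Hom.mk φ)

@[simp] theorem toHom_ofHom (φ : toSpecies.obj X.graph ⟶ monadObj (toSpecies.obj Y.graph)) :
    toHom (ofHom φ) = φ := rfl

theorem toHom_comp (φ : X ⟶ Y) (ψ : Y ⟶ Z) :
    toHom (φ ≫ ψ) = toHom φ ≫ monadMap (toHom ψ) ≫ mu (toSpecies.obj Z.graph) := rfl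

theorem toHom_id : toHom (𝟙 X) = eta (toSpecies.obj X.graph) := rfl

theorem toHom_free (f : X.graph ⟶ Y.graph) :
    toHom (free f) = toSpecies.map f ≫ eta (toSpecies.obj Y.graph) := rfl

/-- By the unit law that substituting a graph into a corolla returns that graph, precomposing with a
free morphism is plain restriction. -/
theorem toHom_free_comp (f : X.graph ⟶ Y.graph) (ψ : Y ⟶ Z) :
    toHom (free f ≫ ψ) = toSpecies.map f ≫ toHom ψ := by
  rw [toHom_comp, toHom_free, Category.assoc]
  refine congrArg (fun t => toSpecies.map f ≫ t) ?_
  rw [← Category.assoc, ← eta_naturality, Category.assoc, left_unit, Category.comp_id]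

/-- By the other unit law, substituting corollas into the vertices of a graph changes nothing, so
only the decorations are pushed along `f`. -/
theorem toHom_comp_free (φ : X ⟶ Y) (f : Y.graph ⟶ Z.graph) :
    toHom (φ ≫ free f) = toHom φ ≫ monadMap (toSpecies.map f) := by
  rw [toHom_comp, toHom_free]
  refine congrArg (fun t => toHom φ ≫ t) ?_
  refine Eq.trans ?_ (Category.comp_id _)
  rw [← right_unit, ← Category.assoc]
  exact congrArg (fun t => t ≫ mu (toSpecies.obj Z.graph))
    (monadFunctor.map_comp (toSpecies.map f) (eta _))

theorem free_comp (f : X.graph ⟶ Y.graph) (g : Y.graph ⟶ Z.graph) :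
    (free (f ≫ g) : X ⟶ Z) = free (R := X) (Y := Y) f ≫ free g :=
  hom_ext_toHom (by rw [toHom_free_comp, toHom_free, toHom_free, toSpecies.map_comp,
    Category.assoc])

theorem free_id : (free (𝟙 X.graph) : X ⟶ X) = 𝟙 X :=
  hom_ext_toHom (by rw [toHom_free, toHom_id, toSpecies.map_id, Category.id_comp])

/-- Free morphisms on covers are epimorphisms. -/
theorem free_cancel {f : X.graph ⟶ Y.graph} (hf : Graph.Hom.IsCover f) {φ ψ : Y ⟶ Z}
    (h : free f ≫ φ = free f ≫ ψ) : φ = ψ := by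
  refine hom_ext_toHom (dec_ext_of_cover hf ?_)
  rw [← toHom_free_comp, ← toHom_free_comp, h]

/-- Genericity can be checked on any representatives of the classes of decorated graphs. -/
theorem isGeneric_iff (φ : X ⟶ Y) (K : ∀ v, DecNGraph (toSpecies.obj Y.graph) (X.graph.Flag v))
    (hK : ∀ v, opMk (K v) = vertOf (toHom φ) v) :
    IsGeneric φ ↔ ∃ e : glue X.graph (fun v => (K v).toNGraph) ≅ Y.graph,
      toSpecies.map e.hom = substDec (toHom φ) K hK := by
  have hV : ∀ v, opMk (vertexGraph φ v) = vertOf (toHom φ) v := fun v => opMk_opOut _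
  constructor
  · rintro ⟨e, he⟩
    obtain ⟨α, hα⟩ := exists_iso_substDec (toHom φ) K (vertexGraph φ) hK hV
    refine ⟨α ≪≫ e, ?_⟩
    rw [← hα]
    exact (toSpecies.map_comp _ _).trans (congrArg (fun t => toSpecies.map α.hom ≫ t) he)
  · rintro ⟨e, he⟩
    obtain ⟨α, hα⟩ := exists_iso_substDec (toHom φ) (vertexGraph φ) K hV hK
    refine ⟨α ≪≫ e, ?_⟩
    refine Eq.trans ?_ hα
    exact (toSpecies.map_comp _ _).trans (congrArg (fun t => toSpecies.map α.hom ≫ t) he)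

/-- Genericity is stable under composition with isomorphisms of graphs. -/
theorem IsGeneric.comp_free {φ : X ⟶ Y} (h : IsGeneric φ) (θ : Y.graph ≅ Z.graph) :
    IsGeneric (φ ≫ (free θ.hom : Y ⟶ Z)) := by
  obtain ⟨e, he⟩ := h
  -- Redecorating the representatives along `θ` leaves the glued graph itself unchanged, so `e`
  -- followed by `θ` is the required isomorphism.
  have hK : ∀ v, opMk ((vertexGraph φ v).map (toSpecies.map θ.hom)) =
      vertOf (toHom (φ ≫ (free θ.hom : Y ⟶ Z))) v := fun v => by
    rw [← monadMap_opMk, toHom_comp_free, vertOf_comp]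
    exact congrArg _ (opMk_opOut _)
  refine (isGeneric_iff _ _ hK).2 ⟨e ≪≫ θ, ?_⟩
  refine (toSpecies.map_comp e.hom θ.hom).trans ?_
  rw [he]
  refine glue_dec_ext (K := fun v => (vertexGraph φ v).toNGraph) (fun a => ?_) (fun v => ?_)
  · refine Eq.trans ?_ (arcOf_substDec_inl _ _ hK a).symm
    rw [toHom_comp_free]
    rfl
  · refine Eq.trans ?_ (glueIncl_substDec _ _ hK v).symm
    exact congrArg (fun t => t ≫ toSpecies.map θ.hom)
      (glueIncl_substDec (toHom φ) (vertexGraph φ) (fun _ => opMk_opOut _) v)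

end RestrictedKleisli

/-! ### Corollas, and isomorphisms of the restricted Kleisli category -/

/-- An effective graph with a single vertex and no inner edges is a corolla. -/
theorem exists_corolla_iso {n : Type} [Finite n] (K : NGraph n) (hV : Subsingleton K.graph.V)
    (hK : ∀ a, ¬ K.graph.IsInner a) :
    ∃ θ : corolla n ≅ K.graph, ∀ j, θ.hom.A ((corollaN n).port j).1 = (K.port j).1 := by
  obtain ⟨v₀⟩ := K.eff.nonempty_V
  -- The flag `h j` sits on the arc opposite to the port `j`; it exists since no edge is isolated.
  choose h hh using fun j => K.i_port_mem j
  -- The arc of a flag is never a port, and here it is not inner, so its opposite is a port.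
  have hs : ∀ k, ∃ j, h j = k := fun k => by
    rcases K.arc_cases (K.graph.s k) with ⟨j, hj⟩ | ⟨j, hj⟩ | hj
    · exact absurd ⟨k, hj⟩ (K.port j).2
    · exact ⟨j, K.graph.s_inj ((hh j).trans hj.symm)⟩
    · exact absurd hj (hK _)
  have hi : Function.Injective h := fun j l e => by
    have e' : K.graph.i (K.port j).1 = K.graph.i (K.port l).1 := by rw [← hh, ← hh, e]
    refine K.port.injective (Subtype.ext ?_)
    rw [← K.graph.i_i (K.port j).1, e', K.graph.i_i]
  have hA : Function.Bijective
      (Sum.elim (fun j => (K.port j).1) (fun j => K.graph.i (K.port j).1) :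
        n ⊕ n → K.graph.A) := by
    constructor
    · rintro (a | a) (b | b) e
      · exact congrArg Sum.inl (K.port.injective (Subtype.ext e))
      · refine absurd (K.i_port_mem b) ?_
        rw [← show (K.port a).1 = K.graph.i (K.port b).1 from e]
        exact (K.port a).2
      · refine absurd (K.i_port_mem a) ?_
        rw [show K.graph.i (K.port a).1 = (K.port b).1 from e]
        exact (K.port b).2
      · refine congrArg Sum.inr (hi (K.graph.s_inj ?_))
        rw [hh, hh]
        exact e
    · intro a
      rcases K.arc_cases a with ⟨j, rfl⟩ | ⟨j, rfl⟩ | ha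
      · exact ⟨Sum.inl j, rfl⟩
      · exact ⟨Sum.inr j, rfl⟩
      · exact absurd ha (hK _)
  refine ⟨isoMk (Equiv.ofBijective _ hA) (Equiv.ofBijective h ⟨hi, hs⟩)
    (Equiv.ofBijective (fun _ => v₀) ⟨fun _ _ _ => rfl, fun w => ⟨(), Subsingleton.elim _ _⟩⟩)
    ?_ (fun j => (hh j).symm) (fun _ => Subsingleton.elim _ _), fun j => rfl⟩
  rintro (a | a)
  · rfl
  · exact (K.graph.i_i _).symm

/-- The class of a decorated graph with a single vertex and no inner edges is in the image of the
unit. -/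
theorem exists_eta_eq {F : Species} {n : Type} [Finite n] (K : DecNGraph F n)
    (hV : Subsingleton K.graph.V) (hK : ∀ a, ¬ K.graph.IsInner a) :
    ∃ x : F.Op n, (eta F).onOp x = opMk K := by
  obtain ⟨θ, hθ⟩ := exists_corolla_iso K.toNGraph hV hK
  have hj : ∀ j, F.col (F.relabel (corollaFlag n ()).symm
      (vertOf (toSpecies.map θ.hom ≫ K.dec) ())) j =
        arcOf K.dec (θ.hom.A (Sum.inr j : n ⊕ n)) := fun j => by
    rw [F.col_relabel]
    exact col_vertOf (toSpecies.map θ.hom ≫ K.dec) () _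
  -- The operation sought is the one decorating the only vertex, with its flags labelled by `n`
  -- through the corolla.
  refine ⟨F.relabel (corollaFlag n ()).symm (vertOf (toSpecies.map θ.hom ≫ K.dec) ()),
    opMk_eq_iff.2 ⟨θ, hθ, dec_ext ?_ ?_⟩⟩
  · rintro (j | j)
    · refine Eq.trans ?_ (congrArg F.inv (hj j)).symm
      exact arcOf_i (toSpecies.map θ.hom ≫ K.dec) (Sum.inr j : n ⊕ n)
    · exact (hj j).symm
  · intro v
    refine Eq.trans ?_ (vertOf_corollaDec _ v).symm
    refine Eq.trans ?_ (F.relabel_trans (n := (corolla n).Flag ()) (m := n)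
      (k := (corolla n).Flag v) _ _ _)
    exact ((congrArg (fun e => F.relabel e _) (Equiv.symm_trans_self _)).trans
      (F.relabel_refl _)).symm

namespace RestrictedKleisli

variable {X Y Z : RestrictedKleisli}

/-- The unit is the identity on colours, so images of arcs can be read off. At a vertex, an
isomorphism of decorated corollas respects the decoration of the single vertex, which recovers the
image of that vertex; images of flags follow from those of arcs. -/
theorem free_injective {f g : X.graph ⟶ Y.graph} (h : (free f : X ⟶ Y) = free g) : f = g := by
  have h' : toHom (free f : X ⟶ Y) = toHom (free g) := congrArg toHom h
  refine hom_ext_of_A_V (fun a => congrArg ULift.down (congrArg (fun φ => arcOf φ a) h'))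
    (fun v => ?_)
  obtain ⟨θ, -, hθ⟩ := opMk_eq_iff.1 (congrArg (fun φ => vertOf φ v) h')
  have e := congrArg (fun φ : toSpecies.obj (corolla (X.graph.Flag v)) ⟶
    toSpecies.obj Y.graph => (ULift.down (vertOf φ ())).1) hθ
  exact e.symm

/-- A morphism all of whose vertex graphs are corollas is free. -/
theorem exists_eq_free (φ : X ⟶ Y) (h : ∀ v, ∃ x, (eta (toSpecies.obj Y.graph)).onOp x =
    vertOf (toHom φ) v) : ∃ f : X.graph ⟶ Y.graph, φ = free f := by
  choose d hd using h
  -- The colours are those of `φ` and the operations are preimages under the unit; they match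
  -- because the unit preserves colours.
  let ψ : toSpecies.obj X.graph ⟶ toSpecies.obj Y.graph :=
    ofLocal (F := toSpecies.obj Y.graph) (arcOf (F := monadObj (toSpecies.obj Y.graph)) (toHom φ))
      (arcOf_i (F := monadObj (toSpecies.obj Y.graph)) (toHom φ)) d (fun v k => by
        have := (eta (toSpecies.obj Y.graph)).map_col (d v) k
        rw [hd, col_vertOf] at this
        exact this.symm)
  refine ⟨graphHom ψ, hom_ext_toHom (Eq.symm ?_)⟩
  rw [toHom_free, map_graphHom]
  refine dec_ext (fun a => rfl) (fun v => ?_)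
  rw [vertOf_comp, show vertOf ψ v = d v from vertOf_ofLocal _ _ _ _ v, hd]

/-- Substituting into `K`, the graph that `φ` assigns to a vertex, must give a corolla. Each vertex
of `K` contributes at least one vertex and each inner edge of `K` stays inner, so `K` has one vertex
and no inner edge. -/
theorem exists_eq_free_of_comp_eq_id {φ : X ⟶ Y} {ψ : Y ⟶ X} (h : φ ≫ ψ = 𝟙 X) :
    ∃ f : X.graph ⟶ Y.graph, φ = free f := by
  refine exists_eq_free φ (fun v => ?_)
  obtain ⟨K, hK⟩ := opMk_surj (vertOf (toHom φ) v)
  rw [← hK]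
  have e : (mu (toSpecies.obj X.graph)).onOp (opMk (K.map (toHom ψ))) =
      vertOf (toHom (𝟙 X)) v := by
    rw [← h, toHom_comp, ← Category.assoc, vertOf_comp, vertOf_comp, ← hK]
    rfl
  rw [mu_opMk (K.map (toHom ψ)) _ (fun _ => opMk_opOut _)] at e
  obtain ⟨θ, -, -⟩ := opMk_eq_iff.1 (e.trans rfl :
    _ = opMk (corollaDec (vertOf (𝟙 (toSpecies.obj X.graph)) v)))
  refine exists_eta_eq K ⟨fun a b => ?_⟩ (fun a ha => ?_)
  · obtain ⟨a'⟩ := (opOut (vertOf (K.map (toHom ψ)).dec a)).eff.nonempty_V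
    obtain ⟨b'⟩ := (opOut (vertOf (K.map (toHom ψ)).dec b)).eff.nonempty_V
    exact congrArg Sigma.fst ((equivV θ).injective
      (Subsingleton.elim (α := Unit) (equivV θ ⟨a, a'⟩) (equivV θ ⟨b, b'⟩)))
  · exact corolla_not_inner _ ((isInner_iso θ _).1 ((isInner_inl_iff a).2 ha))

/-- Isomorphisms of the restricted Kleisli category are free on isomorphisms of graphs. -/
theorem exists_iso_eq_free (e : X ≅ Y) :
    ∃ θ : X.graph ≅ Y.graph, e.hom = free θ.hom := by
  obtain ⟨f, hf⟩ := exists_eq_free_of_comp_eq_id e.hom_inv_id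
  obtain ⟨g, hg⟩ := exists_eq_free_of_comp_eq_id e.inv_hom_id
  refine ⟨⟨f, g, free_injective (X := X) (Y := X) ?_, free_injective (X := Y) (Y := Y) ?_⟩, hf⟩
  · rw [free_comp (Y := Y), free_id, ← hf, ← hg, e.hom_inv_id]
  · rw [free_comp (Y := X), free_id, ← hf, ← hg, e.inv_hom_id]

end RestrictedKleisli

/-! ### The canonical generic morphism and the construction of the pushout -/

namespace RestrictedKleisli

section canonical

variable {X : RestrictedKleisli} (K : ∀ v, NGraph (X.graph.Flag v))

/-- The glued graph as an object of the restricted Kleisli category. -/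
noncomputable def glueObj : RestrictedKleisli :=
  KGraph.mk (glue X.graph K) (glue_noIsolatedEdges X.noIsolatedEdges)

/-- The graphs `K v` over the glued graph. -/
@[reducible]
noncomputable def glueFam (v : X.graph.V) :
    DecNGraph (toSpecies.obj (glue X.graph K)) (X.graph.Flag v) where
  toNGraph := K v
  dec := toSpecies.map (glueIncl X.graph K v)

/-- The port `j` of `K v` is glued to `i (s j)`, and the colour of the flag is the inverse of that
of the port. This is the compatibility needed to define `toGlue`. -/
theorem col_glueFam (v : X.graph.V) (j : X.graph.Flag v) :
    (monadObj (toSpecies.obj (glue X.graph K))).col (opMk (glueFam K v)) j =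
      ULift.up (Sum.inl (X.graph.s j.1) : GlueA X.graph K) := by
  refine congrArg ULift.up ?_
  change glueI X.graph K (glueArc X.graph K v ((K v).port j).1) = _
  rw [← glueArc_i, glueArc_i_port]

/-- The canonical generic morphism from a graph to a graph glued according to it. -/
noncomputable def toGlue : X ⟶ glueObj K :=
  ofHom (ofLocal (F := monadObj (toSpecies.obj (glue X.graph K)))
    (fun a => ULift.up (Sum.inl a : GlueA X.graph K)) (fun _ => rfl)
    (fun v => opMk (glueFam K v)) (col_glueFam K))

theorem vertOf_toGlue (v : X.graph.V) : vertOf (toHom (toGlue K)) v = opMk (glueFam K v) :=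
  (monadObj (toSpecies.obj (glue X.graph K))).relabel_refl (opMk (glueFam K v))

/-- With the `K v` themselves as representatives, the colimit graph is the target, and its
decoration is the identity because it restricts to the inclusion on each piece. -/
theorem isGeneric_toGlue : IsGeneric (toGlue K) := by
  refine (isGeneric_iff _ (glueFam K) (fun v => (vertOf_toGlue K v).symm)).2 ⟨Iso.refl _, ?_⟩
  refine (toSpecies.map_id _).trans (glue_dec_ext (K := K) (fun a => rfl) (fun v => ?_))
  exact (Category.comp_id _).trans (glueIncl_substDec _ (glueFam K) _ v).symm

end canonical

variable {R R' S : RestrictedKleisli}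

/-- A reduced cover and a generic morphism have a pushout consisting of such morphisms. -/
theorem exists_isPushout (r : R.graph ⟶ R'.graph) (g : R ⟶ S)
    (hr : Graph.Hom.IsReducedCover r) (hg : IsGeneric g) :
    ∃ (S' : RestrictedKleisli) (g' : R' ⟶ S') (r' : S.graph ⟶ S'.graph),
      IsPushout (free r) g g' (free r') ∧ IsGeneric g' ∧ Graph.Hom.IsReducedCover r' := by
  have hrV : Function.Bijective r.V := ⟨hr.injective_V, hr.1.1⟩
  have hrA : Function.Surjective r.A := hr.1.2
  let K : ∀ v, NGraph (R.graph.Flag v) := fun v => (vertexGraph g v).toNGraph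
  have hK : ∀ v, opMk (vertexGraph g v) = vertOf (toHom g) v := fun v => opMk_opOut _
  -- The pieces of `S` are carried over to `R'` along the bijection on vertices, with ports
  -- relabelled by the flags at the image vertex.
  obtain ⟨K', hK'⟩ := exists_family (P := fun v => NGraph (R'.graph.Flag v)) hrV
    (fun v => (K v).relabel (Graph.Hom.flagEquiv r v))
  -- The transported pieces agree with the original ones only up to a propositional equality, which
  -- is traded for isomorphisms `κ`.
  have key : ∀ v, ∃ κ : (K v).graph ≅ (K' (r.V v)).graph, ∀ j,
      κ.hom.A ((K v).port j).1 = ((K' (r.V v)).port (Graph.Hom.flagEquiv r v j)).1 := by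
    intro v
    rw [hK']
    exact ⟨Iso.refl _, fun j => congrArg (fun j => ((K v).port j).1)
      (Equiv.symm_apply_apply _ j).symm⟩
  choose κ hκ using key
  obtain ⟨e, he⟩ : ∃ e : glue R.graph K ≅ S.graph, toSpecies.map e.hom = colimDec g := hg
  let S' : RestrictedKleisli := glueObj K'
  let r' : S.graph ⟶ S'.graph := e.inv ≫ glueMap r κ hκ
  have her' : e.hom ≫ r' = glueMap r κ hκ := Iso.hom_inv_id_assoc e _
  have hr'V : Function.Bijective r'.V :=
    (glueMap_bijective_V r κ hκ hrV).comp (equivV e.symm).bijective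
  have hr'A : Function.Surjective r'.A :=
    (glueMap_surjective_A r κ hκ hrV.2 hrA).comp (equivA e.symm).surjective
  have hr' : Graph.Hom.IsReducedCover r' :=
    Graph.Hom.isReducedCover_of_bijective S.noIsolatedEdges hr'V hr'A
  -- Under the identification `e`, genericity makes `g` the canonical morphism into the gluing: the
  -- inclusion on arcs of `R`, and (`hgV`) the inclusion of `K v` at each vertex `v`.
  have hgA : ∀ a, arcOf (toHom g) a = ULift.up (e.hom.A (Sum.inl a : GlueA R.graph K)) :=
    fun a => (congrArg (fun φ : toSpecies.obj (glue R.graph K) ⟶ toSpecies.obj S.graph =>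
      arcOf φ (Sum.inl a : GlueA R.graph K)) he).symm
  have hgV : ∀ v, (vertexGraph g v).dec = toSpecies.map (glueIncl R.graph K v ≫ e.hom) :=
    fun v => (glueIncl_substDec (toHom g) (vertexGraph g) hK v).symm.trans
      ((congrArg (fun t => toSpecies.map (glueIncl R.graph K v) ≫ t) he.symm).trans
        (toSpecies.map_comp _ _).symm)
  have hglue : ∀ v, glueIncl R.graph K v ≫ e.hom ≫ r' =
      (κ v).hom ≫ glueIncl R'.graph K' (r.V v) := fun v => by
    rw [her']
    exact glueIncl_glueMap r κ hκ v
  have w : free r ≫ toGlue K' = g ≫ (free r' : S ⟶ S') := by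
    refine hom_ext_toHom ?_
    rw [toHom_free_comp, toHom_comp_free]
    refine dec_ext (fun a => ?_) (fun v => ?_)
    · refine Eq.trans ?_ (congrArg (toSpecies.map r').C (hgA a)).symm
      exact congrArg ULift.up
        (congrArg (fun f : glue R.graph K ⟶ glue R'.graph K' => f.A (Sum.inl a)) her').symm
    · rw [vertOf_map_comp, vertOf_toGlue, vertOf_comp, ← hK v]
      -- At `v` one side is the class of `K v` and the other that of its copy at `r v`, both lying
      -- over `S'`; `κ v` is an isomorphism between them over `S'`.
      refine (opMk_eq_iff.2 ⟨κ v, fun j => ?_, ?_⟩ : opMk ((vertexGraph g v).map _) =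
        opMk ((glueFam K' (r.V v)).relabel _)).symm
      · exact hκ v j
      · refine Eq.trans ?_ (congrArg (fun t => t ≫ toSpecies.map r') (hgV v)).symm
        refine (toSpecies.map_comp _ _).symm.trans (Eq.trans ?_ (toSpecies.map_comp _ _))
        exact congrArg toSpecies.map ((hglue v).symm.trans (Category.assoc _ _ _).symm)
  have hdesc : ∀ {Y : RestrictedKleisli} (φ : R' ⟶ Y) (ψ : S ⟶ Y), free r ≫ φ = g ≫ ψ →
      ∃ χ : S' ⟶ Y, toGlue K' ≫ χ = φ ∧ free r' ≫ χ = ψ := by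
    intro Y φ ψ h
    obtain ⟨χ, hχ⟩ := exists_descend hr'V hr'A (toHom ψ) (by
      intro a b hab
      obtain ⟨a, rfl⟩ := (equivA e).surjective a
      obtain ⟨b, rfl⟩ := (equivA e).surjective b
      have hab' : (e.hom ≫ r').A a = (e.hom ≫ r').A b := hab
      rw [her'] at hab'
      rcases glueMapA_eq r κ hrV.1 hab' with rfl | ⟨a, b, rfl, rfl, hr⟩
      · rfl
      -- By commutativity of the square, the colour that `ψ` gives to an arc of `R` depends only on
      -- its image under `r`.
      · have hφ : ∀ c, arcOf (toHom ψ) (e.hom.A (Sum.inl c : GlueA R.graph K)) =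
            arcOf (toHom φ) (r.A c) := fun c => by
          have := congrArg (fun φ => arcOf φ c)
            ((toHom_free_comp r φ).symm.trans (congrArg toHom h))
          exact (this.trans (congrArg (toHom ψ).C (hgA c))).symm
        exact (hφ a).trans ((congrArg (arcOf (toHom φ)) hr).trans (hφ b).symm))
    have hχ' : free r' ≫ (ofHom χ : S' ⟶ Y) = ψ := hom_ext_toHom (by
      rw [toHom_free_comp, toHom_ofHom, hχ])
    -- The triangle on `R'` is checked after precomposing with the epimorphism `free r`, where it
    -- follows from the triangle on `S`.
    refine ⟨ofHom χ, free_cancel (X := R) hr.1 ?_, hχ'⟩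
    rw [← Category.assoc, w, Category.assoc, hχ', h]
  refine ⟨S', toGlue K', r', ⟨⟨w⟩, ⟨Limits.PushoutCocone.IsColimit.mk _
    (fun s => (hdesc s.inl s.inr s.condition).choose)
    (fun s => (hdesc s.inl s.inr s.condition).choose_spec.1)
    (fun s => (hdesc s.inl s.inr s.condition).choose_spec.2)
    (fun s m _ hm => free_cancel (X := S) (Y := S') hr'.1
      (hm.trans (hdesc s.inl s.inr s.condition).choose_spec.2.symm))⟩⟩, isGeneric_toGlue K', hr'⟩

end RestrictedKleisli

end KockGraph

/-! ### Existence of the pushout and transfer to every pushout square -/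

theorem mainTheorem2
    (R R' S : KockGraph.RestrictedKleisli) (r : R ⟶ R') (g : R ⟶ S)
    (hr : KockGraph.RestrictedKleisli.IsReducedCover r)
    (hg : KockGraph.RestrictedKleisli.IsGeneric g) :
    CategoryTheory.Limits.HasPushout r g ∧
      ∀ (S' : KockGraph.RestrictedKleisli) (g' : R' ⟶ S') (r' : S ⟶ S'),
        CategoryTheory.IsPushout r g g' r' →
          KockGraph.RestrictedKleisli.IsGeneric g' ∧
            KockGraph.RestrictedKleisli.IsReducedCover r' := by
  obtain ⟨f, hf, rfl⟩ := hr
  obtain ⟨S₀, g₀, r₀, h₀, hg₀, hr₀⟩ :=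
    KockGraph.RestrictedKleisli.exists_isPushout f g hf hg
  refine ⟨h₀.hasPushout, fun S' g' r' h => ?_⟩
  -- The comparison from the constructed pushout to the given one comes from an isomorphism of
  -- graphs, so `g'` and `r'` are the constructed morphisms followed by `free θ.hom`.
  obtain ⟨θ, hθ⟩ := KockGraph.RestrictedKleisli.exists_iso_eq_free (h₀.isoIsPushout _ _ h)
  have hg' : g₀ ≫ KockGraph.RestrictedKleisli.free θ.hom = g' := by
    rw [← hθ, h₀.inl_isoIsPushout_hom]
  have hr' : KockGraph.RestrictedKleisli.free r₀ ≫ KockGraph.RestrictedKleisli.free θ.hom =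
      r' := by
    rw [← hθ, h₀.inr_isoIsPushout_hom]
  refine ⟨hg' ▸ hg₀.comp_free θ, r₀ ≫ θ.hom, ?_, ?_⟩
  · exact KockGraph.Graph.Hom.isReducedCover_of_bijective S.noIsolatedEdges
      ((KockGraph.Graph.equivV θ).bijective.comp ⟨hr₀.injective_V, hr₀.1.1⟩)
      ((KockGraph.Graph.equivA θ).surjective.comp hr₀.1.2)
  · rw [← hr', KockGraph.RestrictedKleisli.free_comp]
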